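/- For $n\ge 0$ let $C_n$ be the poset of nonempty intervals $\{i,i+1,\dots,j\}$ of $\{0<\dots<n\}$, ordered by reverse inclusion and regarded as a category. For a category $\mathcal C$ with pullbacks let $\mathrm{Span}(\mathcal C)$ be the simplicial set whose $n$-cells are the functors $F:C_n\to\mathcal C$ such that for all intervals $I,J$ with $I\cap J\neq\emptyset$ the square formed by $F(I\cup J)$, $F(I)$, $F(J)$, $F(I\cap J)$ is a pullback. Let $\mathrm{Span}=\mathrm{Span}(\mathrm{FinSet})$ and $\mathrm{Span}^\times=\mathrm{Span}(\mathrm{Arr}(\mathrm{FinSet}))$, where $\mathrm{Arr}(\mathrm{FinSet})$ is the category of arrows of finite sets, and let $p:\mathrm{Span}^\times\to\mathrm{Span}$ be the map induced by the codomain functor $(Y\to X)\mapsto X$. For a map of simplicial sets $p:\mathcal E\to\mathcal D$, an edge $f$ of $\mathcal E$ with target $y$ is called $p$-cartesian if $\mathcal E_{/f}\to\mathcal E_{/y}\times_{\mathcal D_{/p(y)}}\mathcal D_{/p(f)}$ is an acyclic Kan fibration (it has the right lifting property with respect to $\partial\Delta^m\to\Delta^m$ for all $m\geq 0$). The map $p$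 is a cartesian fibration if $\mathcal E$ and $\mathcal D$ are quasicategories, $p$ is an inner fibration, and for every edge $g:x\to y$ of $\mathcal D$ and every vertex $\tilde y$ of $\mathcal E$ with $p(\tilde y)=y$ there is a $p$-cartesian edge $\tilde g$ of $\mathcal E$ with target $\tilde y$ and $p(\tilde g)=g$. **Proposition.** The map $p:\mathrm{Span}^\times\to\mathrm{Span}$ is a cartesian fibration. Moreover, for every span of finite sets $g=(X_0\leftarrow X_{01}\to X_1)$, regarded as an edge $X_0\to X_1$ of $\mathrm{Span}$, and every lift $Y_1\to X_1$ of its target to $\mathrm{Span}^\times$, there is a $p$-cartesian edge of $\mathrm{Span}^\times$ over $g$ with target $Y_1\to X_1$ of the form $$\begin{array}{ccccc} Y_0 & \xleftarrow{\;=\;} & Y_{01} & \longrightarrow & Y_1\\ \downarrow & & \downarrow & & \downarrow\\ X_0 & \longleftarrow & X_{01} & \longrightarrow & X_1\end{array}$$ in which $Y_0=Y_{01}$, the top left map is the identity, and the right-hand square is a pullback. -/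

import Mathlib

open CategoryTheory Limits Opposite OrderDual Simplicial

universe v₁ v₂ u₁ u₂ u

/-! ### Span diagrams -/

section Intervals

variable {α β γ : Type} [LinearOrder α] [LinearOrder β] [LinearOrder γ]

/-- The poset of nonempty intervals `[i, j]` of a linear order, ordered by *reverse* inclusion,
regarded as a category. For `α = {0 < ⋯ < n}` this is the indexing category `C_n` of
span diagrams: there is a unique morphism `L ⟶ I` exactly when `I ⊆ L`. -/
abbrev IntervalCat (α : Type) [LinearOrder α] : Type := (NonemptyInterval α)ᵒᵈ

/-- The morphism `L ⟶ I` of `IntervalCat α` given by an inclusion of intervals `I ⊆ L`. -/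
abbrev IntervalCat.res {I L : NonemptyInterval α} (h : I ≤ L) :
    (toDual L : IntervalCat α) ⟶ toDual I :=
  homOfLE (toDual_le_toDual.2 h)

/-- A monotone map sends the interval `[i, j]` to the interval `[f i, f j]`. -/
def IntervalCat.functor (f : α →o β) : IntervalCat α ⥤ IntervalCat β :=
  Monotone.functor (f := fun I => toDual ((ofDual I).map f))
    (fun _ _ h => ⟨f.monotone h.1, f.monotone h.2⟩)

namespace NonemptyInterval

lemma le_of_coe_eq_inter_left {I J K : NonemptyInterval α}
    (hK : (K : Set α) = (I : Set α) ∩ J) : K ≤ I :=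
  coe_subset_coe.1 (hK ▸ Set.inter_subset_left)

lemma le_of_coe_eq_inter_right {I J K : NonemptyInterval α}
    (hK : (K : Set α) = (I : Set α) ∩ J) : K ≤ J :=
  coe_subset_coe.1 (hK ▸ Set.inter_subset_right)

lemma le_of_coe_eq_union_left {I J L : NonemptyInterval α}
    (hL : (L : Set α) = (I : Set α) ∪ J) : I ≤ L :=
  coe_subset_coe.1 (hL ▸ Set.subset_union_left)

lemma le_of_coe_eq_union_right {I J L : NonemptyInterval α}
    (hL : (L : Set α) = (I : Set α) ∪ J) : J ≤ L :=
  coe_subset_coe.1 (hL ▸ Set.subset_union_right)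

end NonemptyInterval

open NonemptyInterval

variable {C : Type u₁} [Category.{v₁} C] {D : Type u₂} [Category.{v₂} D]

/-- The pullback property of a functor `F` on intervals: if `I` and `J` are nonempty intervals
whose intersection `K` is a nonempty interval, and `L` is the interval `I ∪ J`, then
```
F(I ∪ J) ----> F(I)
   |             |
   v             v
 F(J) -----> F(I ∩ J)
```
is a pullback square. -/
def PullbackProperty (F : IntervalCat α ⥤ C) : Prop :=
  ∀ (I J K L : NonemptyInterval α)
    (hK : (K : Set α) = (I : Set α) ∩ J) (hL : (L : Set α) = (I : Set α) ∪ J),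
    IsPullback
      (F.map (IntervalCat.res (le_of_coe_eq_union_left hL)))
      (F.map (IntervalCat.res (le_of_coe_eq_union_right hL)))
      (F.map (IntervalCat.res (le_of_coe_eq_inter_left hK)))
      (F.map (IntervalCat.res (le_of_coe_eq_inter_right hK)))

lemma NonemptyInterval.map_inter (f : α →o β) {I J K : NonemptyInterval α}
    (hK : (K : Set α) = (I : Set α) ∩ J) :
    ((K.map f : NonemptyInterval β) : Set β) = (I.map f : Set β) ∩ (J.map f : Set β) := by
  have h : Set.Icc K.fst K.snd = Set.Icc (max I.fst J.fst) (min I.snd J.snd) := by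
    rw [← Set.Icc_inter_Icc]; exact hK
  have hne : K.fst ≤ K.snd := K.fst_le_snd
  have h' := (Set.Icc_eq_Icc_iff hne).1 h
  rw [coe_def, coe_def, coe_def, Set.Icc_inter_Icc]
  change Set.Icc (f K.fst) (f K.snd) = Set.Icc (max (f I.fst) (f J.fst)) (min (f I.snd) (f J.snd))
  rw [h'.1, h'.2, f.monotone.map_max, f.monotone.map_min]

lemma NonemptyInterval.map_union (f : α →o β) {I J K L : NonemptyInterval α}
    (hK : (K : Set α) = (I : Set α) ∩ J) (hL : (L : Set α) = (I : Set α) ∪ J) :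
    ((L.map f : NonemptyInterval β) : Set β) = (I.map f : Set β) ∪ (J.map f : Set β) := by
  have hI := K.fst_le_snd
  have h1 := le_of_coe_eq_inter_left hK
  have h2 := le_of_coe_eq_inter_right hK
  have hJI : J.fst ≤ I.snd := h2.1.trans (hI.trans h1.2)
  have hIJ : I.fst ≤ J.snd := h1.1.trans (hI.trans h2.2)
  have h : Set.Icc L.fst L.snd = Set.Icc (min I.fst J.fst) (max I.snd J.snd) := by
    rw [← Set.Icc_union_Icc' hJI hIJ]; exact hL
  have h' := (Set.Icc_eq_Icc_iff L.fst_le_snd).1 h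
  rw [coe_def, coe_def, coe_def]
  change Set.Icc (f L.fst) (f L.snd) = Set.Icc (f I.fst) (f I.snd) ∪ Set.Icc (f J.fst) (f J.snd)
  rw [Set.Icc_union_Icc' (f.monotone hJI) (f.monotone hIJ), h'.1, h'.2, f.monotone.map_max,
    f.monotone.map_min]

lemma PullbackProperty.precomp {F : IntervalCat β ⥤ C} (hF : PullbackProperty F) (f : α →o β) :
    PullbackProperty (IntervalCat.functor f ⋙ F) := fun I J K L hK hL =>
  hF (I.map f) (J.map f) (K.map f) (L.map f) (map_inter f hK) (map_union f hK hL)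

lemma PullbackProperty.postcomp {F : IntervalCat α ⥤ C} (hF : PullbackProperty F) (G : C ⥤ D)
    [PreservesLimitsOfShape WalkingCospan G] : PullbackProperty (F ⋙ G) :=
  fun I J K L hK hL => (hF I J K L hK hL).map G

end Intervals

section Span

variable (C : Type u₁) [Category.{v₁} C] {D : Type u₁} [Category.{v₁} D]

/-- The simplicial set `Span(C)`: its `n`-cells are the functors `C_n ⥤ C` with the
pullback property. -/
def Span : SSet.{max u₁ v₁} where
  obj n := {F : IntervalCat (Fin (n.unop.len + 1)) ⥤ C // PullbackProperty F}
  map f := TypeCat.ofHom fun F =>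
    ⟨IntervalCat.functor f.unop.toOrderHom ⋙ F.1, F.2.precomp _⟩
  map_id _ := rfl
  map_comp _ _ := rfl

variable {C}

/-- The functor `C_n ⥤ C` underlying an `n`-cell of `Span(C)`. -/
def Span.diagram {n : SimplexCategoryᵒᵖ} (x : (Span C).obj n) :
    IntervalCat (Fin (n.unop.len + 1)) ⥤ C := x.1

/-- The map `Span(C) ⟶ Span(D)` induced by a functor `C ⥤ D` that preserves pullbacks. -/
def Span.mapOf (G : C ⥤ D) [PreservesLimitsOfShape WalkingCospan G] : Span C ⟶ Span D where
  app _ := TypeCat.ofHom fun F => ⟨Span.diagram F ⋙ G, F.2.postcomp G⟩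
  naturality _ _ _ := rfl

end Span

/-- `Span`, the simplicial set of spans of finite sets. -/
abbrev FinSpan : SSet.{u + 1} := Span FintypeCat.{u}

/-- `Span^×`, the simplicial set of spans in the arrow category of finite sets. -/
abbrev FinSpanTimes : SSet.{u + 1} := Span (Arrow FintypeCat.{u})

/-- The functor `Y ↦ (∅ ⟶ Y)`. -/
noncomputable def arrowOfInitial (C : Type u₁) [Category.{v₁} C] [HasInitial C] : C ⥤ Arrow C where
  obj Y := Arrow.mk (initial.to Y)
  map f := Arrow.homMk (𝟙 _) f (by simp)

/-- The codomain functor `(X ⟶ Y) ↦ Y` is right adjoint to `Y ↦ (∅ ⟶ Y)`. -/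
noncomputable def arrowOfInitialAdj (C : Type u₁) [Category.{v₁} C] [HasInitial C] :
    arrowOfInitial C ⊣ (Arrow.rightFunc : Arrow C ⥤ C) :=
  Adjunction.mkOfHomEquiv
    { homEquiv _ A :=
        { toFun φ := φ.right
          invFun f := Arrow.homMk (initial.to A.left) f (initialIsInitial.hom_ext _ _)
          left_inv _ := Arrow.hom_ext _ _ (initialIsInitial.hom_ext _ _) rfl
          right_inv _ := rfl }
      homEquiv_naturality_left_symm _ _ :=
        Arrow.hom_ext _ _ (initialIsInitial.hom_ext _ _) rfl
      homEquiv_naturality_right _ _ := rfl }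

instance preservesLimitsOfShape_rightFunc :
    PreservesLimitsOfShape WalkingCospan
      (Arrow.rightFunc : Arrow FintypeCat.{u} ⥤ FintypeCat.{u}) :=
  (arrowOfInitialAdj FintypeCat.{u}).rightAdjoint_preservesLimits.preservesLimitsOfShape

/-- The map `p : Span^× ⟶ Span` induced by the codomain functor. -/
def codSpan : FinSpanTimes.{u} ⟶ FinSpan.{u} := Span.mapOf Arrow.rightFunc

/-! ### Slices, cartesian edges and cartesian fibrations -/

section Slice

open AugmentedSimplexCategory

variable {X Y Z : SSet.{u}}

lemma inr'_comp_tensorHomOf {x₁ y₁ x₂ y₂ : SimplexCategory} (f₁ : x₁ ⟶ y₁) (f₂ : x₂ ⟶ y₂) :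
    inr' x₁ x₂ ≫ tensorHomOf f₁ f₂ = f₂ ≫ inr' y₁ y₂ :=
  inr_comp_tensorHom (x₁ := .of x₁) (y₁ := .of y₁) (x₂ := .of x₂) (y₂ := .of y₂) f₁ f₂

lemma tensorHomOf_id (x y : SimplexCategory) : tensorHomOf (𝟙 x) (𝟙 y) = 𝟙 _ :=
  MonoidalCategory.id_tensorHom_id (C := AugmentedSimplexCategory) (.of x) (.of y)

lemma tensorHomOf_comp {x₁ y₁ z₁ x₂ y₂ z₂ : SimplexCategory}
    (f₁ : x₁ ⟶ y₁) (f₂ : x₂ ⟶ y₂) (g₁ : y₁ ⟶ z₁) (g₂ : y₂ ⟶ z₂) :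
    tensorHomOf (f₁ ≫ g₁) (f₂ ≫ g₂) = tensorHomOf f₁ f₂ ≫ tensorHomOf g₁ g₂ :=
  (MonoidalCategory.tensorHom_comp_tensorHom (C := AugmentedSimplexCategory)
    (X₁ := .of x₁) (Y₁ := .of y₁) (Z₁ := .of z₁) (X₂ := .of x₂) (Y₂ := .of y₂) (Z₂ := .of z₂)
    f₁ f₂ g₁ g₂).symm

lemma SSet.map_inr'_tensorHomOf {m n k l : SimplexCategory} (f : m ⟶ n) (g : l ⟶ k)
    (x : X.obj (op (tensorObjOf n k))) :
    X.map (inr' m l).op (X.map (tensorHomOf f g).op x) = X.map g.op (X.map (inr' n k).op x) := by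
  rw [← Functor.map_comp_apply, ← Functor.map_comp_apply, ← op_comp, ← op_comp,
    inr'_comp_tensorHomOf]

lemma SSet.map_tensorHomOf_comp {m n r k l s : SimplexCategory} (f : m ⟶ n) (f' : n ⟶ r)
    (g : l ⟶ k) (g' : k ⟶ s) (x : X.obj (op (tensorObjOf r s))) :
    X.map (tensorHomOf f g).op (X.map (tensorHomOf f' g').op x) =
      X.map (tensorHomOf (f ≫ f') (g ≫ g')).op x := by
  rw [← Functor.map_comp_apply, ← op_comp, tensorHomOf_comp]

/-- Joyal's slice `X_{/σ}` over a `k`-simplex `σ` of `X`. Its `n`-simplices are the maps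
`Δ[n] ⋆ Δ[k] ⟶ X` that restrict to `σ` on `Δ[k]`, that is, as `Δ[n] ⋆ Δ[k] = Δ[n + k + 1]`, the
`(n + k + 1)`-simplices of `X` whose face on the last `k + 1` vertices is `σ`. The simplicial
operator `f` acts through `f ⋆ id`. -/
def SSet.slice (X : SSet.{u}) {k : SimplexCategory} (σ : X.obj (op k)) : SSet.{u} where
  obj n := {τ : X.obj (op (tensorObjOf n.unop k)) // X.map (inr' n.unop k).op τ = σ}
  map f := TypeCat.ofHom fun τ => ⟨X.map (tensorHomOf f.unop (𝟙 k)).op τ.1,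
    (SSet.map_inr'_tensorHomOf f.unop (𝟙 k) τ.1).trans
      ((Functor.map_id_apply X _ _).trans τ.2)⟩
  map_id n := by
    ext τ
    change X.map (tensorHomOf (𝟙 n.unop) (𝟙 k)).op τ.1 = τ.1
    rw [tensorHomOf_id, op_id, Functor.map_id_apply]
  map_comp f g := by
    ext τ
    exact (SSet.map_tensorHomOf_comp g.unop f.unop (𝟙 k) (𝟙 k) τ.1).symm

/-- The map of slices `X_{/σ} ⟶ Y_{/τ}` induced by `q : X ⟶ Y` and an operator `g : [l] ⟶ [k]`
with `τ = g^*(q(σ))`. It sends `Δ[n] ⋆ Δ[k] ⟶ X` to the composite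
`Δ[n] ⋆ Δ[l] ⟶ Δ[n] ⋆ Δ[k] ⟶ X ⟶ Y`. -/
def SSet.sliceMap (q : X ⟶ Y) {k l : SimplexCategory} (g : l ⟶ k)
    (σ : X.obj (op k)) (τ : Y.obj (op l)) (h : Y.map g.op (q.app (op k) σ) = τ) :
    X.slice σ ⟶ Y.slice τ where
  app n := TypeCat.ofHom fun ρ => ⟨Y.map (tensorHomOf (𝟙 n.unop) g).op (q.app _ ρ.1),
    (SSet.map_inr'_tensorHomOf (𝟙 n.unop) g _).trans <|
      (congrArg (Y.map g.op) ((NatTrans.naturality_apply q _ _).symm.trans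
        (congrArg (q.app (op k)) ρ.2))).trans h⟩
  naturality m n f := by
    ext ρ
    refine Subtype.ext ?_
    change Y.map (tensorHomOf (𝟙 n.unop) g).op
        (q.app _ (X.map (tensorHomOf f.unop (𝟙 k)).op ρ.1)) =
      Y.map (tensorHomOf f.unop (𝟙 l)).op (Y.map (tensorHomOf (𝟙 m.unop) g).op (q.app _ ρ.1))
    rw [NatTrans.naturality_apply]
    exact (SSet.map_tensorHomOf_comp (X := Y) (𝟙 n.unop) f.unop g (𝟙 k) _).trans
      (SSet.map_tensorHomOf_comp (X := Y) f.unop (𝟙 m.unop) (𝟙 l) g _).symm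

lemma SSet.sliceMap_comp (q : X ⟶ Y) (r : Y ⟶ Z) {k l m : SimplexCategory} (g : l ⟶ k)
    (g' : m ⟶ l) (σ : X.obj (op k)) (τ : Y.obj (op l)) (υ : Z.obj (op m))
    (h : Y.map g.op (q.app (op k) σ) = τ) (h' : Z.map g'.op (r.app (op l) τ) = υ)
    {t : X ⟶ Z} {e : m ⟶ k} (ht : q ≫ r = t) (he : g' ≫ g = e)
    (h'' : Z.map e.op (t.app (op k) σ) = υ) :
    sliceMap q g σ τ h ≫ sliceMap r g' τ υ h' = sliceMap t e σ υ h'' := by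
  subst ht he
  ext n ρ
  refine Subtype.ext ?_
  change Z.map (tensorHomOf (𝟙 n.unop) g').op
      (r.app _ (Y.map (tensorHomOf (𝟙 n.unop) g).op (q.app _ ρ.1))) =
    Z.map (tensorHomOf (𝟙 n.unop) (g' ≫ g)).op (r.app _ (q.app _ ρ.1))
  rw [NatTrans.naturality_apply]
  exact SSet.map_tensorHomOf_comp (X := Z) (𝟙 n.unop) (𝟙 n.unop) g' g _

/-- The target (last vertex) of an edge. -/
abbrev SSet.target (X : SSet.{u}) (f : X _⦋1⦌) : X _⦋0⦌ := X.δ 0 f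

/-- The canonical map `X_{/f} ⟶ X_{/y} ×_{Y_{/p(y)}} Y_{/p(f)}` attached to
`p : X ⟶ Y` and an edge `f` of `X` with target `y`. -/
noncomputable def SSet.sliceComparison (p : X ⟶ Y) (f : X _⦋1⦌) :
    X.slice f ⟶
      pullback
        (SSet.sliceMap p (𝟙 ⦋0⦌) (X.target f) (p.app _ (X.target f)) (by simp))
        (SSet.sliceMap (𝟙 Y) (SimplexCategory.δ 0) (p.app _ f) (p.app _ (X.target f))
          (NatTrans.naturality_apply p (SimplexCategory.δ 0).op f).symm) :=
  pullback.lift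
    (SSet.sliceMap (𝟙 X) (SimplexCategory.δ 0) f (X.target f) rfl)
    (SSet.sliceMap p (𝟙 ⦋1⦌) f (p.app _ f) (by simp))
    ((SSet.sliceMap_comp (t := p) (e := SimplexCategory.δ 0) (ht := Category.id_comp p)
      (he := Category.id_comp _)
      (h'' := (NatTrans.naturality_apply p (SimplexCategory.δ 0).op f).symm) ..).trans
      (SSet.sliceMap_comp (ht := Category.comp_id p) (he := Category.comp_id _) ..).symm)

/-- An acyclic Kan fibration: a map with the right lifting property for all boundary inclusions
`∂Δ[n] ⟶ Δ[n]`, `n ≥ 0`. -/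
def SSet.IsAcyclicKanFibration (q : X ⟶ Y) : Prop :=
  ∀ n : ℕ, HasLiftingProperty (SSet.boundary.{u} n).ι q

/-- The edge `f` of `X` is `p`-cartesian. -/
def SSet.IsCartesianEdge (p : X ⟶ Y) (f : X _⦋1⦌) : Prop :=
  SSet.IsAcyclicKanFibration (SSet.sliceComparison p f)

/-- `p : X ⟶ Y` is a cartesian fibration: `X` and `Y` are quasicategories, `p` is an inner
fibration, and for every edge `g : x ⟶ y` of `Y` and every lift `y'` of `y`
there is a `p`-cartesian edge of `X` with target `y'` that `p` sends to `g`. -/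
structure SSet.IsCartesianFibration (p : X ⟶ Y) : Prop where
  quasicategory_source : SSet.Quasicategory X
  quasicategory_target : SSet.Quasicategory Y
  innerFibration : SSet.InnerFibration p
  exists_cartesian_lift : ∀ (g : Y _⦋1⦌) (y : X _⦋0⦌), p.app _ y = Y.target g →
    ∃ f : X _⦋1⦌, p.app _ f = g ∧ X.target f = y ∧ SSet.IsCartesianEdge p f

end Slice

/-! ### The explicit lifts -/

section Explicit

/-- The intervals `{0}`, `{1}` and `{0, 1}` of `{0 < 1}`. -/
abbrev int0 : NonemptyInterval (Fin 2) := ⟨(0, 0), le_rfl⟩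
abbrev int1 : NonemptyInterval (Fin 2) := ⟨(1, 1), le_rfl⟩
abbrev int01 : NonemptyInterval (Fin 2) := ⟨(0, 1), Fin.zero_le _⟩

lemma int0_le : int0 ≤ int01 := ⟨le_rfl, Fin.zero_le _⟩
lemma int1_le : int1 ≤ int01 := ⟨Fin.zero_le _, le_rfl⟩

variable {C : Type u₁} [Category.{v₁} C]

/-- The left leg `F₀₁ ⟶ F₀` of a span `F`. -/
def Span.leftLeg (F : (Span C) _⦋1⦌) :
    (Span.diagram F).obj (toDual int01) ⟶ (Span.diagram F).obj (toDual int0) :=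
  (Span.diagram F).map (IntervalCat.res int0_le)

/-- The right leg `F₀₁ ⟶ F₁` of a span `F`. -/
def Span.rightLeg (F : (Span C) _⦋1⦌) :
    (Span.diagram F).obj (toDual int01) ⟶ (Span.diagram F).obj (toDual int1) :=
  (Span.diagram F).map (IntervalCat.res int1_le)

/-- An edge
```
Y₀ <---- Y₀₁ ----> Y₁
|         |         |
v         v         v
X₀ <---- X₀₁ ----> X₁
```
of `Span^×` is of "identity-then-pullback" form if `Y₀ = Y₀₁`, the map `Y₀₁ ⟶ Y₀` is
the identity, and the right-hand square is a pullback. -/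
structure IsIdentityThenPullback (F : FinSpanTimes.{u} _⦋1⦌) : Prop where
  exists_eq : ∃ h : ((Span.diagram F).obj (toDual int01)).left =
      ((Span.diagram F).obj (toDual int0)).left,
    (Span.leftLeg F).left = eqToHom h
  isPullback : IsPullback (Span.rightLeg F).left
    ((Span.diagram F).obj (toDual int01)).hom ((Span.diagram F).obj (toDual int1)).hom
    (Span.rightLeg F).right

end Explicit

/-! In a functor on intervals, the value at `[i, j]` belongs to the edge from `i` to `j`, and the
map `[i, j] ⟶ [i', j']` belongs to the possibly degenerate 3-simplex `i ≤ i' ≤ j' ≤ j`. A horn in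
`Span(C)` is therefore a partial functor: it is known on the intervals and maps whose endpoints miss
a common vertex other than `k` (`HornFamily`, `InHorn`). To fill the horn is to extend this partial
functor, with strict equality on the horn, to a functor with the pullback property.

For an inner horn, the intervals in `[0, k]` miss the last vertex and those in `[k, n]` miss `0`, so
both sides of `k` are known completely. The filler is then forced up to isomorphism: its value at an
interval `I` that contains `k` is the fibre product over `{k}` of the values at `I ∩ [0, k]` and `I
∩ [k, n]` (`exists_isFiller_inner`). The same universal property makes any two fillers isomorphic
relative to the horn (`exists_iso_of_isFiller`). A filler in the arrow category can thus be moved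
along an isomorphism of codomains until it lies over a prescribed filler
(`exists_isFiller_inner_over`). This gives the quasicategories and the inner fibration.

For cartesian edges, the union of `∂Δ[m] ⋆ Δ[1]` and `Δ[m] ⋆ {1}` is the horn `Λ[m + 2, m + 2]`, so
it is enough to lift horns whose last edge is `f` (`LiftsLastHorns.isCartesianEdge`). Put `n = m +
2` and `t = n - 1`. The codomains `X` are given on all intervals and only the domains `Y` must be
extended. Since `Y [t, n] ⟶ Y {t}` is invertible, so are its pullbacks `Y [i, n] ⟶ Y [i, t]`, and
the intervals that end at `t` can be traded for those that end at `n`. The remaining intervals all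
lie in the horn, and only maps into `[t, n]` may be missing. These are supplied by the pullback `Y
[t, n] = Y {n} ×_{X {n}} X [t, n]` (`exists_isFiller_outer_over`). Finally,
`exists_isIdentityThenPullback` constructs an edge of the required form by one pullback of finite
sets. -/

/-! ### Functors on intervals -/

section IntervalFunctors

variable {α β : Type} [LinearOrder α] [LinearOrder β]
variable {C : Type u₁} [Category.{v₁} C] {D : Type u₂} [Category.{v₂} D]

/-- The interval `[i, j]`. -/
abbrev IntervalCat.mk (i j : α) (h : i ≤ j) : NonemptyInterval α := ⟨(i, j), h⟩

lemma IntervalCat.map_res_comp (F : IntervalCat α ⥤ C) {I J K : NonemptyInterval α}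
    (h : J ≤ I) (h' : K ≤ J) :
    F.map (res h) ≫ F.map (res h') = F.map (res (h'.trans h)) :=
  (F.map_comp _ _).symm

lemma IntervalCat.map_res_self (F : IntervalCat α ⥤ C) {I : NonemptyInterval α} (h : I ≤ I) :
    F.map (res h) = 𝟙 _ :=
  F.map_id _

instance IntervalCat.isIso_map_res_self (F : IntervalCat α ⥤ C) {I : NonemptyInterval α}
    (h : I ≤ I) : IsIso (F.map (res h)) := by
  rw [map_res_self]; infer_instance

lemma IntervalCat.eq_res {I J : IntervalCat α} (f : I ⟶ J) :
    f = res (I := ofDual J) (L := ofDual I) (leOfHom f) :=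
  Subsingleton.elim _ _

/-- The square of a functor on intervals attached to `i ≤ i' ≤ j' ≤ j` is a pullback. -/
def IsPullbackQuad (F : IntervalCat α ⥤ C) {i i' j' j : α} (h₁ : i ≤ i') (h₂ : i' ≤ j')
    (h₃ : j' ≤ j) : Prop :=
  IsPullback
    (F.map (IntervalCat.res (L := IntervalCat.mk i j (h₁.trans (h₂.trans h₃)))
      (I := IntervalCat.mk i j' (h₁.trans h₂)) ⟨le_rfl, h₃⟩))
    (F.map (IntervalCat.res (L := IntervalCat.mk i j (h₁.trans (h₂.trans h₃)))
      (I := IntervalCat.mk i' j (h₂.trans h₃)) ⟨h₁, le_rfl⟩))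
    (F.map (IntervalCat.res (L := IntervalCat.mk i j' (h₁.trans h₂))
      (I := IntervalCat.mk i' j' h₂) ⟨h₁, le_rfl⟩))
    (F.map (IntervalCat.res (L := IntervalCat.mk i' j (h₂.trans h₃))
      (I := IntervalCat.mk i' j' h₂) ⟨le_rfl, h₃⟩))

lemma PullbackProperty.isPullbackQuad {F : IntervalCat α ⥤ C} (hF : PullbackProperty F)
    {i i' j' j : α} (h₁ : i ≤ i') (h₂ : i' ≤ j') (h₃ : j' ≤ j) :
    IsPullbackQuad F h₁ h₂ h₃ := by
  refine hF (IntervalCat.mk i j' (h₁.trans h₂)) (IntervalCat.mk i' j (h₂.trans h₃))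
    (IntervalCat.mk i' j' h₂) (IntervalCat.mk i j (h₁.trans (h₂.trans h₃))) ?_ ?_
  · ext x
    simp only [NonemptyInterval.coe_def, Set.mem_inter_iff, Set.mem_Icc]
    constructor
    · rintro ⟨a, b⟩; exact ⟨⟨h₁.trans a, b⟩, a, b.trans h₃⟩
    · rintro ⟨⟨a, b⟩, c, d⟩; exact ⟨c, b⟩
  · ext x
    simp only [NonemptyInterval.coe_def, Set.mem_union, Set.mem_Icc]
    constructor
    · rintro ⟨a, b⟩
      rcases le_total x j' with h | h
      · exact Or.inl ⟨a, h⟩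
      · exact Or.inr ⟨h₂.trans h, b⟩
    · rintro (⟨a, b⟩ | ⟨a, b⟩)
      · exact ⟨a, b.trans h₃⟩
      · exact ⟨h₁.trans a, b⟩

lemma NonemptyInterval.eq_of_coe_eq_inter {I J K L : NonemptyInterval α}
    (hK : (K : Set α) = (I : Set α) ∩ J) (hL : (L : Set α) = (I : Set α) ∪ J) :
    K.fst = max I.fst J.fst ∧ K.snd = min I.snd J.snd ∧
      L.fst = min I.fst J.fst ∧ L.snd = max I.snd J.snd := by
  have hI := K.fst_le_snd
  have h1 := le_of_coe_eq_inter_left hK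
  have h2 := le_of_coe_eq_inter_right hK
  have h : Set.Icc K.fst K.snd = Set.Icc (max I.fst J.fst) (min I.snd J.snd) := by
    rw [← Set.Icc_inter_Icc]; exact hK
  have h' : Set.Icc L.fst L.snd = Set.Icc (min I.fst J.fst) (max I.snd J.snd) := by
    rw [← Set.Icc_union_Icc' (h2.1.trans (hI.trans h1.2)) (h1.1.trans (hI.trans h2.2))]
    exact hL
  have e := (Set.Icc_eq_Icc_iff hI).1 h
  have e' := (Set.Icc_eq_Icc_iff L.fst_le_snd).1 h'
  exact ⟨e.1, e.2, e'.1, e'.2⟩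

/-- Two overlapping intervals are either staggered, which gives a quad up to a flip, or nested, in
which case two opposite sides of the square are identities. -/
lemma PullbackProperty.of_isPullbackQuad {F : IntervalCat α ⥤ C}
    (H : ∀ (i i' j' j : α) (h₁ : i ≤ i') (h₂ : i' ≤ j') (h₃ : j' ≤ j),
      IsPullbackQuad F h₁ h₂ h₃) : PullbackProperty F := by
  rintro ⟨⟨i, j⟩, hI⟩ ⟨⟨i', j'⟩, hJ⟩ ⟨⟨a, b⟩, hK'⟩ ⟨⟨c, d⟩, hL'⟩ hK hL
  obtain ⟨e₁, e₂, e₃, e₄⟩ := NonemptyInterval.eq_of_coe_eq_inter hK hL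
  dsimp only at e₁ e₂ e₃ e₄ hI hJ hK' hL'
  rcases le_total i i' with h | h <;> rcases le_total j j' with h' | h' <;>
    simp only [max_eq_left, max_eq_right, min_eq_left, min_eq_right, h, h'] at e₁ e₂ e₃ e₄ <;>
    subst e₁ e₂ e₃ e₄
  · exact H _ _ _ _ h hK' h'
  · exact IsPullback.of_horiz_isIso ⟨by simp only [IntervalCat.map_res_comp]⟩
  · exact IsPullback.of_vert_isIso ⟨by simp only [IntervalCat.map_res_comp]⟩
  · exact (H _ _ _ _ h hK' h').flip

section Paste

variable {F : IntervalCat α ⥤ C} {i i' i'' j'' j' j : α}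

lemma IsPullbackQuad.paste_fst {h₁ : i ≤ i'} {h₁' : i' ≤ i''} {h₂ : i'' ≤ j'} {h₃ : j' ≤ j}
    (H : IsPullbackQuad F h₁ (h₁'.trans h₂) h₃) (H' : IsPullbackQuad F h₁' h₂ h₃) :
    IsPullbackQuad F (h₁.trans h₁') h₂ h₃ := by
  have := IsPullback.paste_vert H H'
  simp only [IntervalCat.map_res_comp] at this
  exact this

lemma IsPullbackQuad.cancel_fst {h₁ : i ≤ i'} {h₁' : i' ≤ i''} {h₂ : i'' ≤ j'} {h₃ : j' ≤ j}
    (H : IsPullbackQuad F (h₁.trans h₁') h₂ h₃) (H' : IsPullbackQuad F h₁' h₂ h₃) :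
    IsPullbackQuad F h₁ (h₁'.trans h₂) h₃ := by
  refine IsPullback.of_bot ?_ ?_ H'
  · simp only [IntervalCat.map_res_comp]
    exact H
  · simp only [IntervalCat.map_res_comp]

lemma IsPullbackQuad.paste_snd {h₁ : i ≤ i'} {h₂ : i' ≤ j''} {h₃' : j'' ≤ j'} {h₃ : j' ≤ j}
    (H : IsPullbackQuad F h₁ (h₂.trans h₃') h₃) (H' : IsPullbackQuad F h₁ h₂ h₃') :
    IsPullbackQuad F h₁ h₂ (h₃'.trans h₃) := by
  have := IsPullback.paste_horiz H H'
  simp only [IntervalCat.map_res_comp] at this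
  exact this

lemma IsPullbackQuad.cancel_snd {h₁ : i ≤ i'} {h₂ : i' ≤ j''} {h₃' : j'' ≤ j'} {h₃ : j' ≤ j}
    (H : IsPullbackQuad F h₁ h₂ (h₃'.trans h₃)) (H' : IsPullbackQuad F h₁ h₂ h₃') :
    IsPullbackQuad F h₁ (h₂.trans h₃') h₃ := by
  refine IsPullback.of_right ?_ ?_ H'
  · simp only [IntervalCat.map_res_comp]
    exact H
  · simp only [IntervalCat.map_res_comp]

/-- The pullback property can be checked on the intervals on either side of `k` and on the
squares that divide an interval at `k`. -/
lemma PullbackProperty.of_split (k : α)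
    (Hl : ∀ (i i' j' j : α) (h₁ : i ≤ i') (h₂ : i' ≤ j') (h₃ : j' ≤ j), j ≤ k →
      IsPullbackQuad F h₁ h₂ h₃)
    (Hr : ∀ (i i' j' j : α) (h₁ : i ≤ i') (h₂ : i' ≤ j') (h₃ : j' ≤ j), k ≤ i →
      IsPullbackQuad F h₁ h₂ h₃)
    (Hk : ∀ (i j : α) (h₁ : i ≤ k) (h₂ : k ≤ j), IsPullbackQuad F h₁ le_rfl h₂) :
    PullbackProperty F := by
  -- Cancelling one square divided at `k` from another gives the squares whose overlap starts at
  -- `k`; a second cancellation, on the left, gives those whose overlap contains `k`.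
  have H₁ : ∀ {i j' j : α} (h₁ : i ≤ k) (h₂ : k ≤ j') (h₃ : j' ≤ j),
      IsPullbackQuad F h₁ h₂ h₃ := fun h₁ h₂ h₃ =>
    (Hk _ _ h₁ (h₂.trans h₃)).cancel_snd (Hk _ _ h₁ h₂)
  have H₂ : ∀ {i i' j' j : α} (h₁ : i ≤ i') (h : i' ≤ k) (h₂ : k ≤ j') (h₃ : j' ≤ j),
      IsPullbackQuad F h₁ (h.trans h₂) h₃ := fun h₁ h h₂ h₃ =>
    (H₁ (h₁.trans h) h₂ h₃).cancel_fst (H₁ h h₂ h₃)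
  refine .of_isPullbackQuad fun i i' j' j h₁ h₂ h₃ => ?_
  rcases le_total j k with hj | hj
  · exact Hl _ _ _ _ _ _ _ hj
  rcases le_total k i with hi | hi
  · exact Hr _ _ _ _ _ _ _ hi
  rcases le_total i' k with hi' | hi'
  · rcases le_total k j' with hj' | hj'
    · exact H₂ h₁ hi' hj' h₃
    -- An overlap on one side of `k` is reached by pasting a square whose overlap touches `k` with a
    -- square on that side.
    · exact (H₂ h₁ hi' le_rfl hj).paste_snd (Hl _ _ _ _ h₁ h₂ hj' le_rfl)
  · exact (H₁ hi (hi'.trans h₂) h₃).paste_fst (Hr _ _ _ _ hi' h₂ h₃ le_rfl)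

end Paste

end IntervalFunctors

/-- A functor out of a preorder is determined by a family of properties of maps that is closed
under identities and composition and has a unique solution for every `x ≤ y`. -/
lemma exists_functor_of_existsUnique {P : Type*} [Preorder P] {C : Type u₁} [Category.{v₁} C]
    (O : P → C) (good : ∀ {x y : P}, x ≤ y → (O x ⟶ O y) → Prop)
    (id : ∀ x : P, good (le_refl x) (𝟙 (O x)))
    (comp : ∀ {x y z : P} (h : x ≤ y) (h' : y ≤ z) (f : O x ⟶ O y) (g : O y ⟶ O z),
      good h f → good h' g → good (h.trans h') (f ≫ g))
    (ex : ∀ {x y : P} (h : x ≤ y), ∃ f, good h f)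
    (uniq : ∀ {x y : P} (h : x ≤ y) (f g : O x ⟶ O y), good h f → good h g → f = g) :
    ∃ m : ∀ {x y : P}, x ≤ y → (O x ⟶ O y), (∀ {x y : P} (h : x ≤ y), good h (m h)) ∧
      (∀ x, m (le_refl x) = 𝟙 (O x)) ∧
      (∀ {x y z : P} (h : x ≤ y) (h' : y ≤ z), m (h.trans h') = m h ≫ m h') :=
  ⟨fun h => (ex h).choose, fun h => (ex h).choose_spec,
    fun x => uniq _ _ _ (ex _).choose_spec (id x),
    fun h h' => uniq _ _ _ (ex _).choose_spec
      (comp h h' _ _ (ex h).choose_spec (ex h').choose_spec)⟩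

open NonemptyInterval

/-! ### Families of span diagrams on the faces of a horn -/

section Tuples

variable {α : Type} [LinearOrder α]

/-- The two endpoints of an interval, as a monotone map. -/
def NonemptyInterval.edge (I : NonemptyInterval α) : Fin 2 →o α where
  toFun := ![I.fst, I.snd]
  monotone' := Fin.monotone_iff_le_succ.2 (by simpa using I.fst_le_snd)

/-- The four endpoints of two nested intervals, as a monotone map. -/
def NonemptyInterval.quad {I J : NonemptyInterval α} (h : J ≤ I) : Fin 4 →o α where
  toFun := ![I.fst, J.fst, J.snd, I.snd]
  monotone' := Fin.monotone_iff_le_succ.2 (by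
    simpa [Fin.forall_fin_succ] using ⟨h.1, J.fst_le_snd, h.2⟩)

end Tuples

section HornFamily

variable {n : ℕ} {k : Fin (n + 1)}

/-- The monotone map `x` misses a vertex other than `k`. -/
abbrev Misses (k : Fin (n + 1)) {m : ℕ} (x : Fin (m + 1) →o Fin (n + 1)) : Prop :=
  ∃ a, a ≠ k ∧ ∀ i, x i ≠ a

/-- `a` is not an endpoint of `I`. -/
abbrev Avoids (a : Fin (n + 1)) (I : NonemptyInterval (Fin (n + 1))) : Prop :=
  I.fst ≠ a ∧ I.snd ≠ a

/-- The endpoints of `I` and `J` lie in a face of the horn. -/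
abbrev InHorn (k : Fin (n + 1)) (I J : NonemptyInterval (Fin (n + 1))) : Prop :=
  ∃ a, a ≠ k ∧ Avoids a I ∧ Avoids a J

lemma InHorn.left {I J : NonemptyInterval (Fin (n + 1))} (h : InHorn k I J) : InHorn k I I :=
  let ⟨a, ha, hI, _⟩ := h; ⟨a, ha, hI, hI⟩

lemma InHorn.right {I J : NonemptyInterval (Fin (n + 1))} (h : InHorn k I J) : InHorn k J J :=
  let ⟨a, ha, _, hJ⟩ := h; ⟨a, ha, hJ, hJ⟩

variable (n k) in
/-- A compatible family of span diagrams, one for each simplex of the horn `Λ[n, k]`. -/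
structure HornFamily (C : Type u₁) [Category.{v₁} C] where
  cell {m : ℕ} (x : Fin (m + 1) →o Fin (n + 1)) (hx : Misses k x) :
    IntervalCat (Fin (m + 1)) ⥤ C
  pullbackProperty {m : ℕ} (x : Fin (m + 1) →o Fin (n + 1)) (hx : Misses k x) :
    PullbackProperty (cell x hx)
  cell_comp {m l : ℕ} (x : Fin (m + 1) →o Fin (n + 1)) (y : Fin (l + 1) →o Fin (m + 1))
    (hx : Misses k x) (hxy : Misses k (x.comp y)) :
    cell (x.comp y) hxy = IntervalCat.functor y ⋙ cell x hx

/-- The monotone map that moves `a` to a neighbour and fixes all other vertices. -/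
lemma exists_collapse {a : Fin (n + 1)} (ha : a ≠ k) :
    ∃ x : Fin (n + 1) →o Fin (n + 1), (∀ i, x i ≠ a) ∧ ∀ i, i ≠ a → x i = i := by
  have hn : 0 < n := by
    by_contra h
    exact ha (Fin.ext (by omega))
  refine ⟨⟨fun i => if i = a then
    (if h : a.1 = 0 then ⟨1, by omega⟩ else ⟨a.1 - 1, by omega⟩) else i, ?_⟩, ?_, ?_⟩
  · intro i j hij
    rw [Fin.le_def] at hij
    simp only
    split_ifs with h₁ h₂ h₃ h₃ h₂ h₃ <;> simp only [Fin.le_def, Fin.ext_iff] at * <;> omega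
  · intro i
    change (if _ then _ else _) ≠ a
    split_ifs with h₁ h₂ <;> simp only [ne_eq, Fin.ext_iff] at * <;> omega
  · intro i hi
    exact if_neg hi

namespace HornFamily

variable {C : Type u₁} [Category.{v₁} C] {D : Type u₂} [Category.{v₂} D] (H : HornFamily n k C)

/-- The image of a horn family under a functor. -/
def postcomp (G : C ⥤ D) [PreservesLimitsOfShape WalkingCospan G] : HornFamily n k D where
  cell x hx := H.cell x hx ⋙ G
  pullbackProperty x hx := (H.pullbackProperty x hx).postcomp G
  cell_comp x y hx hxy := by rw [H.cell_comp x y hx hxy]; rfl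

lemma misses_edge {I : NonemptyInterval (Fin (n + 1))} (h : InHorn k I I) : Misses k I.edge := by
  obtain ⟨a, ha, hI, -⟩ := h
  exact ⟨a, ha, Fin.forall_fin_two.2 ⟨hI.1, hI.2⟩⟩

lemma misses_quad {I J : NonemptyInterval (Fin (n + 1))} (h : J ≤ I) (h' : InHorn k I J) :
    Misses k (quad h) := by
  obtain ⟨a, ha, hI, hJ⟩ := h'
  refine ⟨a, ha, ?_⟩
  simp only [Fin.forall_fin_succ]
  exact ⟨hI.1, hJ.1, hJ.2, hI.2, fun i => i.elim0⟩

lemma inHorn_map {m : ℕ} {x : Fin (m + 1) →o Fin (n + 1)} (hx : Misses k x)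
    (I J : NonemptyInterval (Fin (m + 1))) : InHorn k (I.map x) (J.map x) := by
  obtain ⟨a, ha, h⟩ := hx
  exact ⟨a, ha, ⟨h _, h _⟩, h _, h _⟩

lemma cell_congr {m : ℕ} {x y : Fin (m + 1) →o Fin (n + 1)} (h : x = y) (hx : Misses k x)
    (hy : Misses k y) : H.cell x hx = H.cell y hy := by
  subst h; rfl

/-- The value of the family on an interval whose endpoints lie in the horn. -/
def obj (I : NonemptyInterval (Fin (n + 1))) (h : InHorn k I I) : C :=
  (H.cell I.edge (misses_edge h)).obj (toDual int01)

lemma obj_congr {I J : NonemptyInterval (Fin (n + 1))} (e : I = J) (hI : InHorn k I I)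
    (hJ : InHorn k J J) : H.obj I hI = H.obj J hJ := by
  subst e; rfl

/-- Restricting the cell along the edge of `I` gives the cell of the edge of `I.map x`, so
compatibility makes a value depend only on the image interval and not on the simplex that contains
it. -/
lemma cell_obj {m : ℕ} (x : Fin (m + 1) →o Fin (n + 1)) (hx : Misses k x)
    (I : NonemptyInterval (Fin (m + 1))) :
    (H.cell x hx).obj (toDual I) = H.obj (I.map x) (inHorn_map hx I I) := by
  have e : (I.map x).edge = x.comp I.edge := by
    ext i; fin_cases i <;> rfl
  have e' := (H.cell_congr e (misses_edge (inHorn_map hx I I))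
    (e ▸ misses_edge (inHorn_map hx I I))).trans (H.cell_comp x I.edge hx _)
  exact (Functor.congr_obj e' (toDual int01)).symm

lemma cell_quad_obj_left {I J : NonemptyInterval (Fin (n + 1))} (h : J ≤ I) (h' : InHorn k I J) :
    (H.cell (quad h) (misses_quad h h')).obj (toDual (IntervalCat.mk 0 3 (Fin.zero_le _))) =
      H.obj I h'.left :=
  H.cell_obj _ _ _

lemma cell_quad_obj_right {I J : NonemptyInterval (Fin (n + 1))} (h : J ≤ I)
    (h' : InHorn k I J) :
    (H.cell (quad h) (misses_quad h h')).obj (toDual (IntervalCat.mk 1 2 (by decide))) =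
      H.obj J h'.right :=
  H.cell_obj _ _ _

/-- The map of the family attached to nested intervals with endpoints in a face of the horn. -/
def hom {I J : NonemptyInterval (Fin (n + 1))} (h : J ≤ I) (h' : InHorn k I J) :
    H.obj I h'.left ⟶ H.obj J h'.right :=
  eqToHom (H.cell_quad_obj_left h h').symm ≫
    (H.cell (quad h) (misses_quad h h')).map
      (IntervalCat.res (L := IntervalCat.mk 0 3 (Fin.zero_le _))
        (I := IntervalCat.mk 1 2 (by decide)) ⟨Fin.zero_le _, by decide⟩) ≫
    eqToHom (H.cell_quad_obj_right h h')

/-- The same argument as for objects, with the four endpoints of the nested pair in place of an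
edge. -/
lemma cell_map {m : ℕ} (x : Fin (m + 1) →o Fin (n + 1)) (hx : Misses k x)
    {I J : NonemptyInterval (Fin (m + 1))} (h : J ≤ I) :
    (H.cell x hx).map (IntervalCat.res h) =
      eqToHom (H.cell_obj x hx I) ≫ H.hom (I := I.map x) (J := J.map x)
        ⟨x.monotone h.1, x.monotone h.2⟩ (inHorn_map hx I J) ≫
        eqToHom (H.cell_obj x hx J).symm := by
  have h₀ : J.map x ≤ I.map x := ⟨x.monotone h.1, x.monotone h.2⟩
  have e : quad h₀ = x.comp (quad h) := by
    ext i; fin_cases i <;> rfl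
  have e' := (H.cell_congr e (misses_quad h₀ (inHorn_map hx I J))
    (e ▸ misses_quad h₀ (inHorn_map hx I J))).trans (H.cell_comp x (quad h) hx _)
  have e'' := Functor.congr_hom e' (IntervalCat.res (L := IntervalCat.mk 0 3 (Fin.zero_le _))
        (I := IntervalCat.mk 1 2 (by decide)) ⟨Fin.zero_le _, by decide⟩)
  unfold hom
  rw [e'']
  simp only [Category.assoc, eqToHom_trans, eqToHom_trans_assoc]
  exact (by simp : (H.cell x hx).map (IntervalCat.res h) =
    𝟙 _ ≫ (H.cell x hx).map (IntervalCat.res h) ≫ 𝟙 _)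

/-- The family restricted to the face opposite to `a` is a functor. -/
lemma exists_hom_eq {a : Fin (n + 1)} (ha : a ≠ k) :
    ∃ (F : IntervalCat (Fin (n + 1)) ⥤ C) (_ : PullbackProperty F)
      (e : ∀ (I) (hI : Avoids a I), H.obj I ⟨a, ha, hI, hI⟩ = F.obj (toDual I)),
      ∀ {I J} (h : J ≤ I) (hI : Avoids a I) (hJ : Avoids a J),
        H.hom h ⟨a, ha, hI, hJ⟩ =
          eqToHom (e I hI) ≫ F.map (IntervalCat.res h) ≫ eqToHom (e J hJ).symm := by
  -- A degenerate cell on all `n + 1` vertices stands in for the face opposite `a`. It fixes the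
  -- intervals that avoid `a`, so no reindexing of vertices is needed.
  obtain ⟨x, hx, hx'⟩ := exists_collapse ha
  have hI' : ∀ I, Avoids a I → I.map x = I := fun I hI => by
    ext
    · simp [hx' _ hI.1]
    · simp [hx' _ hI.2]
  have key : ∀ (I) (hI : Avoids a I), H.obj I ⟨a, ha, hI, hI⟩ =
      (H.cell x ⟨a, ha, hx⟩).obj (toDual I) := fun I hI => by
    rw [H.cell_obj]
    exact H.obj_congr (hI' I hI).symm _ _
  refine ⟨H.cell x ⟨a, ha, hx⟩, H.pullbackProperty _ _, key, ?_⟩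
  intro I J h hI hJ
  rw [H.cell_map]
  have aux : ∀ {I' J'} (eI : I' = I) (eJ : J' = J) (h' : J' ≤ I') (h'' : InHorn k I' J'),
      H.hom h ⟨a, ha, hI, hJ⟩ = eqToHom (H.obj_congr eI.symm _ _) ≫ H.hom h' h'' ≫
        eqToHom (H.obj_congr eJ _ _) := by
    rintro _ _ rfl rfl h' h''; simp
  rw [aux (hI' I hI) (hI' J hJ) ⟨x.monotone h.1, x.monotone h.2⟩ (inHorn_map ⟨a, ha, hx⟩ I J)]
  simp

lemma hom_self (I : NonemptyInterval (Fin (n + 1))) (h : InHorn k I I) :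
    H.hom le_rfl h = 𝟙 _ := by
  obtain ⟨a, ha, hI, -⟩ := h
  obtain ⟨F, -, e, he⟩ := H.exists_hom_eq ha
  rw [he le_rfl hI hI, IntervalCat.map_res_self]
  simp

/-- One vertex avoided by all three intervals puts the triangle in a single face, where the family
is a functor; the pairwise conditions could come from three different faces. -/
lemma hom_comp {L I J : NonemptyInterval (Fin (n + 1))} (h : I ≤ L) (h' : J ≤ I)
    (hh : ∃ a, a ≠ k ∧ Avoids a L ∧ Avoids a I ∧ Avoids a J) (hLI : InHorn k L I)
    (hIJ : InHorn k I J) (hLJ : InHorn k L J) :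
    H.hom h hLI ≫ H.hom h' hIJ = H.hom (h'.trans h) hLJ := by
  obtain ⟨a, ha, hL, hI, hJ⟩ := hh
  obtain ⟨F, -, e, he⟩ := H.exists_hom_eq ha
  rw [he h hL hI, he h' hI hJ, he (h'.trans h) hL hJ]
  simp [← IntervalCat.map_res_comp F h h']

/-- The endpoints of `L` and `K` occur among those of `I` and `J`, so a vertex avoided by `I` and
`J` puts the whole square in one face. -/
lemma isPullback_hom {L I J K : NonemptyInterval (Fin (n + 1))} (hI : I ≤ L) (hJ : J ≤ L)
    (hKI : K ≤ I) (hKJ : K ≤ J) (e₁ : I.fst = L.fst) (e₂ : J.snd = L.snd) (e₃ : K.fst = J.fst)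
    (e₄ : K.snd = I.snd) (hh : ∃ a, a ≠ k ∧ Avoids a I ∧ Avoids a J)
    (w₁ : InHorn k L I) (w₂ : InHorn k L J) (w₃ : InHorn k I K) (w₄ : InHorn k J K) :
    IsPullback (H.hom hI w₁) (H.hom hJ w₂) (H.hom hKI w₃) (H.hom hKJ w₄) := by
  obtain ⟨⟨i, j⟩, hL⟩ := L
  obtain ⟨⟨_, j'⟩, hI'⟩ := I
  obtain ⟨⟨i', _⟩, hJ'⟩ := J
  obtain ⟨⟨_, _⟩, hK'⟩ := K
  dsimp only at e₁ e₂ e₃ e₄ hL hI' hJ' hK'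
  subst e₁ e₂ e₃ e₄
  obtain ⟨a, ha, ⟨n₁, n₂⟩, n₃, n₄⟩ := hh
  dsimp only at n₁ n₂ n₃ n₄
  obtain ⟨F, hF, e, he⟩ := H.exists_hom_eq ha
  refine IsPullback.of_iso (hF.isPullbackQuad hJ.1 hK' hI.2) (eqToIso (e _ ⟨n₁, n₄⟩).symm)
    (eqToIso (e _ ⟨n₁, n₂⟩).symm) (eqToIso (e _ ⟨n₃, n₄⟩).symm) (eqToIso (e _ ⟨n₃, n₂⟩).symm)
    ?_ ?_ ?_ ?_
  · rw [he _ ⟨n₁, n₄⟩ ⟨n₁, n₂⟩]; simp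
  · rw [he _ ⟨n₁, n₄⟩ ⟨n₃, n₄⟩]; simp
  · rw [he _ ⟨n₁, n₂⟩ ⟨n₃, n₂⟩]; simp
  · rw [he _ ⟨n₃, n₄⟩ ⟨n₃, n₂⟩]; simp

lemma isIso_hom {I J : NonemptyInterval (Fin (n + 1))} (h : J ≤ I) (e : J = I)
    (h' : InHorn k I J) : IsIso (H.hom h h') := by
  subst e
  rw [H.hom_self]
  infer_instance

end HornFamily

end HornFamily

/-! ### Fillers of horn families -/

section Filler

lemma PullbackProperty.of_iso {α : Type} [LinearOrder α] {C : Type u₁} [Category.{v₁} C]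
    {F G : IntervalCat α ⥤ C} (hF : PullbackProperty F) (e : F ≅ G) : PullbackProperty G :=
  fun I J K L hK hL => IsPullback.of_iso (hF I J K L hK hL) (e.app _) (e.app _) (e.app _)
    (e.app _) (by simp) (by simp) (by simp) (by simp)

/-- Cells of `Span` are compared by equality of functors, while universal properties produce
isomorphisms. An isomorphism whose components are transports bridges the two. -/
lemma CategoryTheory.NatIso.functor_eq_of_app_eq_eqToHom {C : Type u₁} [Category.{v₁} C]
    {D : Type u₂} [Category.{v₂} D] {F G : C ⥤ D} (α : F ≅ G)
    (h : ∀ X, ∃ e : F.obj X = G.obj X, α.hom.app X = eqToHom e) : F = G := by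
  refine Functor.ext (fun X => (h X).choose) fun X Y f => ?_
  have hX := (h X).choose_spec
  have hY := (h Y).choose_spec
  have := α.hom.naturality f
  rw [hX, hY] at this
  rw [← reassoc_of% this]
  simp

variable {n : ℕ} {k : Fin (n + 1)} {C : Type u₁} [Category.{v₁} C]

namespace HornFamily

variable (H : HornFamily n k C)

/-- A functor on all intervals that restricts to the given family on the horn. -/
def IsFiller (G : IntervalCat (Fin (n + 1)) ⥤ C) : Prop :=
  ∀ {m : ℕ} (x : Fin (m + 1) →o Fin (n + 1)) (hx : Misses k x),
    IntervalCat.functor x ⋙ G = H.cell x hx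

variable {H} {G : IntervalCat (Fin (n + 1)) ⥤ C}

lemma IsFiller.of_obj_map
    (e : ∀ (I) (hI : InHorn k I I), G.obj (toDual I) = H.obj I hI)
    (he : ∀ {I J} (h : J ≤ I) (h' : InHorn k I J), G.map (IntervalCat.res h) =
      eqToHom (e I h'.left) ≫ H.hom h h' ≫ eqToHom (e J h'.right).symm) :
    H.IsFiller G := by
  intro m x hx
  refine CategoryTheory.Functor.ext
    (fun I => (e _ (inHorn_map hx _ _)).trans (H.cell_obj x hx _).symm) ?_
  have key : ∀ {I J : NonemptyInterval (Fin (m + 1))} (h : J ≤ I),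
      (IntervalCat.functor x ⋙ G).map (IntervalCat.res h) =
        eqToHom ((e _ (inHorn_map hx I I)).trans (H.cell_obj x hx I).symm) ≫
          (H.cell x hx).map (IntervalCat.res h) ≫
          eqToHom ((e _ (inHorn_map hx J J)).trans (H.cell_obj x hx J).symm).symm := by
    intro I J h
    rw [H.cell_map x hx h]
    refine Eq.trans (he (I := I.map x) (J := J.map x)
      ⟨x.monotone h.1, x.monotone h.2⟩ (inHorn_map hx _ _)) ?_
    simp
    rfl
  intro I J f
  rw [IntervalCat.eq_res f]
  exact key _

lemma IsFiller.obj_eq (hG : H.IsFiller G) (I : NonemptyInterval (Fin (n + 1)))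
    (hI : InHorn k I I) : G.obj (toDual I) = H.obj I hI :=
  Functor.congr_obj (hG I.edge (misses_edge hI)) (toDual int01)

lemma IsFiller.map_eq (hG : H.IsFiller G) {I J : NonemptyInterval (Fin (n + 1))} (h : J ≤ I)
    (h' : InHorn k I J) : G.map (IntervalCat.res h) =
      eqToHom (hG.obj_eq I h'.left) ≫ H.hom h h' ≫ eqToHom (hG.obj_eq J h'.right).symm := by
  have := Functor.congr_hom (hG (quad h) (misses_quad h h'))
    (IntervalCat.res (L := IntervalCat.mk 0 3 (Fin.zero_le _))
        (I := IntervalCat.mk 1 2 (by decide)) ⟨Fin.zero_le _, by decide⟩)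
  refine Eq.trans this ?_
  unfold hom
  simp only [Category.assoc, eqToHom_trans, eqToHom_trans_assoc]
  rfl

lemma IsFiller.postcomp (hG : H.IsFiller G) {D : Type u₂} [Category.{v₂} D] (P : C ⥤ D)
    [PreservesLimitsOfShape WalkingCospan P] : (H.postcomp P).IsFiller (G ⋙ P) :=
  fun x hx => congrArg (· ⋙ P) (hG x hx)

/-- A functor that is compatibly isomorphic to the family on the horn is isomorphic to a
filler. -/
lemma exists_isFiller_of_iso (hG : PullbackProperty G)
    (ε : ∀ (I) (hI : InHorn k I I), G.obj (toDual I) ≅ H.obj I hI)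
    (hε : ∀ {I J} (h : J ≤ I) (h' : InHorn k I J),
      G.map (IntervalCat.res h) ≫ (ε J h'.right).hom = (ε I h'.left).hom ≫ H.hom h h') :
    ∃ (G' : IntervalCat (Fin (n + 1)) ⥤ C) (hG' : H.IsFiller G') (α : G ≅ G'),
      PullbackProperty G' ∧
      (∀ (I) (hI : InHorn k I I), α.hom.app (toDual I) = (ε I hI).hom ≫
        eqToHom (hG'.obj_eq I hI).symm) ∧
      ∀ (I), ¬ InHorn k I I → ∃ e : G.obj (toDual I) = G'.obj (toDual I),
        α.hom.app (toDual I) = eqToHom e := by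
  classical
  -- Objects are replaced only where the family prescribes a value. Elsewhere the comparison is an
  -- `eqToHom`, which later keeps the codomains strictly equal to given ones.
  let O : IntervalCat (Fin (n + 1)) → C := fun I =>
    if hI : InHorn k (ofDual I) (ofDual I) then H.obj _ hI else G.obj I
  have hO : ∀ (I) (hI : InHorn k I I), O (toDual I) = H.obj I hI := fun I hI => dif_pos hI
  have hO' : ∀ (I), ¬ InHorn k I I → G.obj (toDual I) = O (toDual I) := fun I hI =>
    (dif_neg (c := InHorn k I I) (t := fun hI => H.obj _ hI) (e := fun _ => G.obj (toDual I))
      hI).symm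
  let e : ∀ I, G.obj I ≅ O I := fun I =>
    if hI : InHorn k (ofDual I) (ofDual I) then
      ε (ofDual I) hI ≪≫ eqToIso (hO _ hI).symm else eqToIso (hO' _ hI)
  have he : ∀ (I) (hI : InHorn k I I), e (toDual I) = ε I hI ≪≫ eqToIso (hO _ hI).symm :=
    fun I hI => dif_pos hI
  have he' : ∀ (I) (hI : ¬ InHorn k I I), e (toDual I) = eqToIso (hO' _ hI) :=
    fun I hI => dif_neg hI
  have hfill : H.IsFiller (G.copyObj O e) := by
    refine IsFiller.of_obj_map hO ?_
    intro I J h h'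
    have h₁ := hε h h'
    simp only [Functor.copyObj, he I h'.left, he J h'.right, Iso.trans_inv, Iso.trans_hom,
      eqToIso.inv, eqToIso.hom, Category.assoc]
    rw [reassoc_of% h₁]
    simp
  refine ⟨G.copyObj O e, hfill, G.isoCopyObj O e, hG.of_iso (G.isoCopyObj O e), ?_, ?_⟩
  · intro I hI
    simp [he I hI]
    rfl
  · intro I hI
    exact ⟨hO' I hI, by simp [he' I hI]; rfl⟩

end HornFamily

end Filler

/-! ### Inner horns -/

section Inner

variable {n : ℕ} {k : Fin (n + 1)}

/-- The part of `I` to the left of `k`. -/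
def NonemptyInterval.leftPart (k : Fin (n + 1)) (I : NonemptyInterval (Fin (n + 1)))
    (h : I.fst ≤ k) : NonemptyInterval (Fin (n + 1)) :=
  ⟨(I.fst, min I.snd k), le_min I.fst_le_snd h⟩

/-- The part of `I` to the right of `k`. -/
def NonemptyInterval.rightPart (k : Fin (n + 1)) (I : NonemptyInterval (Fin (n + 1)))
    (h : k ≤ I.snd) : NonemptyInterval (Fin (n + 1)) :=
  ⟨(max I.fst k, I.snd), max_le I.fst_le_snd h⟩

section Parts

variable {I J : NonemptyInterval (Fin (n + 1))}

lemma leftPart_le (h : I.fst ≤ k) : I.leftPart k h ≤ I := ⟨le_rfl, min_le_left _ _⟩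

lemma rightPart_le (h : k ≤ I.snd) : I.rightPart k h ≤ I := ⟨le_max_left _ _, le_rfl⟩

lemma leftPart_mono (hJI : J ≤ I) (hJ : J.fst ≤ k) :
    J.leftPart k hJ ≤ I.leftPart k (hJI.1.trans hJ) :=
  ⟨hJI.1, min_le_min_right _ hJI.2⟩

lemma rightPart_mono (hJI : J ≤ I) (hJ : k ≤ J.snd) :
    J.rightPart k hJ ≤ I.rightPart k (hJ.trans hJI.2) :=
  ⟨max_le_max_right _ hJI.1, hJI.2⟩

lemma pure_le_leftPart (h : I.fst ≤ k) (h' : k ≤ I.snd) : pure k ≤ I.leftPart k h :=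
  ⟨h, le_min h' le_rfl⟩

lemma pure_le_rightPart (h : I.fst ≤ k) (h' : k ≤ I.snd) : pure k ≤ I.rightPart k h' :=
  ⟨max_le h le_rfl, h'⟩

lemma Avoids.of_snd_le (hk : k < Fin.last n) (hI : I.snd ≤ k) : Avoids (Fin.last n) I :=
  ⟨((I.fst_le_snd.trans hI).trans_lt hk).ne, (hI.trans_lt hk).ne⟩

lemma Avoids.of_le_fst (hk : 0 < k) (hI : k ≤ I.fst) : Avoids 0 I :=
  ⟨(hk.trans_le hI).ne', (hk.trans_le (hI.trans I.fst_le_snd)).ne'⟩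

/-- Innerness of the horn enters here: everything to the left of `k` lies in the face opposite the
last vertex. -/
lemma inHorn_of_snd_le (hk : k < Fin.last n) (hI : I.snd ≤ k) (hJ : J.snd ≤ k) :
    InHorn k I J :=
  ⟨Fin.last n, hk.ne', .of_snd_le hk hI, .of_snd_le hk hJ⟩

lemma inHorn_of_le_fst (hk : 0 < k) (hI : k ≤ I.fst) (hJ : k ≤ J.fst) :
    InHorn k I J :=
  ⟨0, hk.ne, .of_le_fst hk hI, .of_le_fst hk hJ⟩

lemma Avoids.leftPart {a : Fin (n + 1)} (hI : Avoids a I) (ha : a ≠ k) (h : I.fst ≤ k) :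
    Avoids a (I.leftPart k h) :=
  ⟨hI.1, by
    rcases min_choice I.snd k with e | e <;>
      simp [NonemptyInterval.leftPart, e, hI.2, ha.symm]⟩

lemma Avoids.rightPart {a : Fin (n + 1)} (hI : Avoids a I) (ha : a ≠ k) (h : k ≤ I.snd) :
    Avoids a (I.rightPart k h) :=
  ⟨by
    rcases max_choice I.fst k with e | e <;>
      simp [NonemptyInterval.rightPart, e, hI.1, ha.symm], hI.2⟩

end Parts

namespace HornFamily

variable {C : Type u₁} [Category.{v₁} C] (H : HornFamily n k C) (h₀ : 0 < k)
  (h₁ : k < Fin.last n)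

/-- The maps of the family between intervals to the left of `k`. -/
def homL {I J : NonemptyInterval (Fin (n + 1))} (h : J ≤ I) (hI : I.fst ≤ k) (hJ : J.fst ≤ k) :
    H.obj (I.leftPart k hI) (inHorn_of_snd_le h₁ (min_le_right _ _) (min_le_right _ _)) ⟶
      H.obj (J.leftPart k hJ) (inHorn_of_snd_le h₁ (min_le_right _ _) (min_le_right _ _)) :=
  H.hom (leftPart_mono h hJ) (inHorn_of_snd_le h₁ (min_le_right _ _) (min_le_right _ _))

/-- The maps of the family between intervals to the right of `k`. -/
def homR {I J : NonemptyInterval (Fin (n + 1))} (h : J ≤ I) (hI : k ≤ I.snd) (hJ : k ≤ J.snd) :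
    H.obj (I.rightPart k hI) (inHorn_of_le_fst h₀ (le_max_right _ _) (le_max_right _ _)) ⟶
      H.obj (J.rightPart k hJ) (inHorn_of_le_fst h₀ (le_max_right _ _) (le_max_right _ _)) :=
  H.hom (rightPart_mono h hJ) (inHorn_of_le_fst h₀ (le_max_right _ _) (le_max_right _ _))

/-- The map of the family from the left part of an interval to `{k}`. -/
def homLK {I : NonemptyInterval (Fin (n + 1))} (h : I.fst ≤ k) (h' : k ≤ I.snd) :
    H.obj (I.leftPart k h) (inHorn_of_snd_le h₁ (min_le_right _ _) (min_le_right _ _)) ⟶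
      H.obj (pure k) (inHorn_of_snd_le h₁ le_rfl le_rfl) :=
  H.hom (pure_le_leftPart h h') (inHorn_of_snd_le h₁ (min_le_right _ _) le_rfl)

/-- The map of the family from the right part of an interval to `{k}`. -/
def homRK {I : NonemptyInterval (Fin (n + 1))} (h : I.fst ≤ k) (h' : k ≤ I.snd) :
    H.obj (I.rightPart k h') (inHorn_of_le_fst h₀ (le_max_right _ _) (le_max_right _ _)) ⟶
      H.obj (pure k) (inHorn_of_snd_le h₁ le_rfl le_rfl) :=
  H.hom (pure_le_rightPart h h') (inHorn_of_le_fst h₀ (le_max_right _ _) le_rfl)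

section

variable {L I J : NonemptyInterval (Fin (n + 1))}

lemma homL_comp (h : I ≤ L) (h' : J ≤ I) (hL : L.fst ≤ k) (hI : I.fst ≤ k) (hJ : J.fst ≤ k) :
    H.homL h₁ h hL hI ≫ H.homL h₁ h' hI hJ = H.homL h₁ (h'.trans h) hL hJ :=
  H.hom_comp (leftPart_mono h hI) (leftPart_mono h' hJ)
    ⟨_, h₁.ne', .of_snd_le h₁ (min_le_right _ _), .of_snd_le h₁ (min_le_right _ _),
      .of_snd_le h₁ (min_le_right _ _)⟩ _ _ _

lemma homR_comp (h : I ≤ L) (h' : J ≤ I) (hL : k ≤ L.snd) (hI : k ≤ I.snd) (hJ : k ≤ J.snd) :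
    H.homR h₀ h hL hI ≫ H.homR h₀ h' hI hJ = H.homR h₀ (h'.trans h) hL hJ :=
  H.hom_comp (rightPart_mono h hI) (rightPart_mono h' hJ)
    ⟨_, h₀.ne, .of_le_fst h₀ (le_max_right _ _), .of_le_fst h₀ (le_max_right _ _),
      .of_le_fst h₀ (le_max_right _ _)⟩ _ _ _

lemma homL_homLK (h : J ≤ I) (hI : I.fst ≤ k) (hJ : J.fst ≤ k) (hJ' : k ≤ J.snd) :
    H.homL h₁ h hI hJ ≫ H.homLK h₁ hJ hJ' = H.homLK h₁ hI (hJ'.trans h.2) :=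
  H.hom_comp (leftPart_mono h hJ) (pure_le_leftPart hJ hJ')
    ⟨_, h₁.ne', .of_snd_le h₁ (min_le_right _ _), .of_snd_le h₁ (min_le_right _ _),
      .of_snd_le h₁ le_rfl⟩ _ _ _

lemma homR_homRK (h : J ≤ I) (hI : k ≤ I.snd) (hJ : J.fst ≤ k) (hJ' : k ≤ J.snd) :
    H.homR h₀ h hI hJ' ≫ H.homRK h₀ h₁ hJ hJ' = H.homRK h₀ h₁ (h.1.trans hJ) hI :=
  H.hom_comp (rightPart_mono h hJ') (pure_le_rightPart hJ hJ')
    ⟨_, h₀.ne, .of_le_fst h₀ (le_max_right _ _), .of_le_fst h₀ (le_max_right _ _),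
      .of_le_fst h₀ le_rfl⟩ _ _ _

lemma homL_self (h : I ≤ I) (hI hI' : I.fst ≤ k) : H.homL h₁ h hI hI' = 𝟙 _ := H.hom_self _ _

lemma homR_self (h : I ≤ I) (hI hI' : k ≤ I.snd) : H.homR h₀ h hI hI' = 𝟙 _ := H.hom_self _ _

end

/-- A cone over the part of the family on the subintervals of `I` that lie on one side of
`k`. -/
structure SideCone (I : NonemptyInterval (Fin (n + 1))) where
  pt : C
  left (h : I.fst ≤ k) : pt ⟶ H.obj (I.leftPart k h)
    (inHorn_of_snd_le h₁ (min_le_right _ _) (min_le_right _ _))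
  right (h : k ≤ I.snd) : pt ⟶ H.obj (I.rightPart k h)
    (inHorn_of_le_fst h₀ (le_max_right _ _) (le_max_right _ _))
  w (h : I.fst ≤ k) (h' : k ≤ I.snd) : left h ≫ H.homLK h₁ h h' = right h' ≫ H.homRK h₀ h₁ h h'

namespace SideCone

variable {H h₀ h₁} {I J : NonemptyInterval (Fin (n + 1))}

/-- The condition that a map of cone points lies over `J ≤ I`. -/
def IsOver (c : SideCone H h₀ h₁ I) (c' : SideCone H h₀ h₁ J) (h : J ≤ I)
    (f : c.pt ⟶ c'.pt) : Prop :=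
  (∀ hJ : J.fst ≤ k, f ≫ c'.left hJ = c.left (h.1.trans hJ) ≫ H.homL h₁ h _ hJ) ∧
  (∀ hJ : k ≤ J.snd, f ≫ c'.right hJ = c.right (hJ.trans h.2) ≫ H.homR h₀ h _ hJ)

/-- The universal property of a limit cone. -/
def IsLim (c : SideCone H h₀ h₁ I) : Prop :=
  ∀ c' : SideCone H h₀ h₁ I, ∃! f, c'.IsOver c le_rfl f

lemma isOver_id (c : SideCone H h₀ h₁ I) : c.IsOver c le_rfl (𝟙 _) :=
  ⟨fun _ => by simp [homL_self], fun _ => by simp [homR_self]⟩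

lemma IsOver.comp {L : NonemptyInterval (Fin (n + 1))} {c : SideCone H h₀ h₁ L}
    {c' : SideCone H h₀ h₁ I} {c'' : SideCone H h₀ h₁ J} {h : I ≤ L} {h' : J ≤ I}
    {f : c.pt ⟶ c'.pt} {g : c'.pt ⟶ c''.pt} (hf : c.IsOver c' h f) (hg : c'.IsOver c'' h' g) :
    c.IsOver c'' (h'.trans h) (f ≫ g) :=
  ⟨fun hJ => by
    rw [Category.assoc, hg.1, reassoc_of% hf.1 (h'.1.trans hJ), homL_comp],
   fun hJ => by
    rw [Category.assoc, hg.2, reassoc_of% hf.2 (hJ.trans h'.2), homR_comp]⟩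

/-- The restriction of a cone to a smaller interval. -/
def restrict (c : SideCone H h₀ h₁ I) (h : J ≤ I) : SideCone H h₀ h₁ J where
  pt := c.pt
  left hJ := c.left (h.1.trans hJ) ≫ H.homL h₁ h _ hJ
  right hJ := c.right (hJ.trans h.2) ≫ H.homR h₀ h _ hJ
  w hJ hJ' := by
    rw [Category.assoc, Category.assoc, homL_homLK, homR_homRK, c.w]

lemma isOver_restrict_iff (c : SideCone H h₀ h₁ I) (c' : SideCone H h₀ h₁ J) (h : J ≤ I)
    (f : c.pt ⟶ c'.pt) : (c.restrict h).IsOver c' le_rfl f ↔ c.IsOver c' h f := by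
  simp only [IsOver, restrict, homL_self, homR_self, Category.comp_id]

/-- A cone over `I` restricts to one over `J`. Limit cones therefore determine the restriction maps
between their points, and their functoriality as well. -/
lemma IsLim.existsUnique {c' : SideCone H h₀ h₁ J} (hc : c'.IsLim) (c : SideCone H h₀ h₁ I)
    (h : J ≤ I) : ∃! f, c.IsOver c' h f := by
  obtain ⟨f, hf, hu⟩ := hc (c.restrict h)
  exact ⟨f, (c.isOver_restrict_iff c' h f).1 hf,
    fun g hg => hu g ((c.isOver_restrict_iff c' h g).2 hg)⟩

lemma IsLim.hom_ext {c' : SideCone H h₀ h₁ J} (hc : c'.IsLim) {c : SideCone H h₀ h₁ I}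
    {h : J ≤ I} {f g : c.pt ⟶ c'.pt} (hf : c.IsOver c' h f) (hg : c.IsOver c' h g) : f = g :=
  (hc.existsUnique c h).unique hf hg

lemma isLim_of_isPullback (c : SideCone H h₀ h₁ I) (h : I.fst ≤ k) (h' : k ≤ I.snd)
    (hc : IsPullback (c.left h) (c.right h') (H.homLK h₁ h h') (H.homRK h₀ h₁ h h')) :
    c.IsLim := by
  intro c'
  refine ⟨hc.lift _ _ (c'.w h h'), ⟨fun _ => by simp [homL_self], fun _ => by simp [homR_self]⟩,
    fun f hf => hc.hom_ext ?_ ?_⟩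
  · simpa [homL_self] using hf.1 h
  · simpa [homR_self] using hf.2 h'

lemma IsLim.isPullback {c : SideCone H h₀ h₁ I} (hc : c.IsLim) (h : I.fst ≤ k)
    (h' : k ≤ I.snd) :
    IsPullback (c.left h) (c.right h') (H.homLK h₁ h h') (H.homRK h₀ h₁ h h') := by
  let c' (s : PullbackCone (H.homLK h₁ h h') (H.homRK h₀ h₁ h h')) : SideCone H h₀ h₁ I :=
    ⟨s.pt, fun _ => s.fst, fun _ => s.snd, fun _ _ => s.condition⟩
  refine ⟨⟨c.w h h'⟩, ⟨PullbackCone.IsLimit.mk _ (fun s => (hc (c' s)).choose) ?_ ?_ ?_⟩⟩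
  · intro s
    simpa [homL_self] using (hc (c' s)).choose_spec.1.1 h
  · intro s
    simpa [homR_self] using (hc (c' s)).choose_spec.1.2 h'
  · intro s m hm hm'
    refine (hc (c' s)).choose_spec.2 m ⟨fun _ => ?_, fun _ => ?_⟩
    · simpa [homL_self] using hm
    · simpa [homR_self] using hm'

/-- An interval strictly to the left of `k` has no right leg, so its diagram is a single object. -/
lemma isLim_of_isIso_left (c : SideCone H h₀ h₁ I) (h : I.fst ≤ k) (h' : ¬ k ≤ I.snd)
    [IsIso (c.left h)] : c.IsLim := fun c' =>
  ⟨c'.left h ≫ inv (c.left h), ⟨fun _ => by simp [homL_self], fun hI => (h' hI).elim⟩,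
    fun f hf => by simpa [homL_self] using hf.1 h⟩

lemma isLim_of_isIso_right (c : SideCone H h₀ h₁ I) (h : ¬ I.fst ≤ k) (h' : k ≤ I.snd)
    [IsIso (c.right h')] : c.IsLim := fun c' =>
  ⟨c'.right h' ≫ inv (c.right h'), ⟨fun hI => (h hI).elim, fun _ => by simp [homR_self]⟩,
    fun f hf => by simpa [homR_self] using hf.2 h'⟩

variable (H h₀ h₁) in
lemma exists_isLim [HasPullbacks C] (I : NonemptyInterval (Fin (n + 1))) :
    ∃ c : SideCone H h₀ h₁ I, c.IsLim := by
  by_cases h : I.fst ≤ k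
  · by_cases h' : k ≤ I.snd
    · exact ⟨⟨pullback (H.homLK h₁ h h') (H.homRK h₀ h₁ h h'), fun _ => pullback.fst _ _,
        fun _ => pullback.snd _ _, fun _ _ => pullback.condition⟩,
        isLim_of_isPullback _ h h' (IsPullback.of_hasPullback _ _)⟩
    · let c : SideCone H h₀ h₁ I := ⟨H.obj (I.leftPart k h)
          (inHorn_of_snd_le h₁ (min_le_right _ _) (min_le_right _ _)),
        fun _ => 𝟙 _, fun h => (h' h).elim, fun _ h => (h' h).elim⟩
      have : IsIso (c.left h) := by dsimp [c]; infer_instance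
      exact ⟨c, isLim_of_isIso_left c h h'⟩
  · have h' : k ≤ I.snd := (not_le.1 h).le.trans I.fst_le_snd
    let c : SideCone H h₀ h₁ I := ⟨H.obj (I.rightPart k h')
        (inHorn_of_le_fst h₀ (le_max_right _ _) (le_max_right _ _)),
        fun hI => (h hI).elim, fun _ => 𝟙 _, fun hI _ => (h hI).elim⟩
    have : IsIso (c.right h') := by dsimp [c]; infer_instance
    exact ⟨c, isLim_of_isIso_right c h h'⟩

/-- The cone on the value of the family at an interval with endpoints in the horn. -/
def ofInHorn (hI : InHorn k I I) : SideCone H h₀ h₁ I where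
  pt := H.obj I hI
  left h := H.hom (leftPart_le h) (let ⟨a, ha, h', _⟩ := hI; ⟨a, ha, h', h'.leftPart ha h⟩)
  right h := H.hom (rightPart_le h) (let ⟨a, ha, h', _⟩ := hI; ⟨a, ha, h', h'.rightPart ha h⟩)
  w h h' := by
    obtain ⟨a, ha, hI, -⟩ := hI
    -- Because `a ≠ k`, the interval `{k}` lies in the same face as `I` and its two parts.
    have hk : Avoids a (pure k) := ⟨ha.symm, ha.symm⟩
    refine (H.hom_comp _ _ ⟨a, ha, hI, hI.leftPart ha h, hk⟩ _ _ ⟨a, ha, hI, hk⟩).trans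
      (H.hom_comp _ _ ⟨a, ha, hI, hI.rightPart ha h', hk⟩ _ _ ⟨a, ha, hI, hk⟩).symm

/-- If `I` contains `k`, the square dividing `I` at `k` lies in one face of the horn, where it is
already a pullback; otherwise `I` equals one of its parts. -/
lemma isLim_ofInHorn (hI : InHorn k I I) : (ofInHorn hI : SideCone H h₀ h₁ I).IsLim := by
  by_cases h : I.fst ≤ k
  · by_cases h' : k ≤ I.snd
    · refine isLim_of_isPullback _ h h' ?_
      obtain ⟨a, ha, hI, -⟩ := hI
      exact H.isPullback_hom (leftPart_le h) (rightPart_le h') (pure_le_leftPart h h')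
        (pure_le_rightPart h h') rfl rfl (max_eq_right h).symm (min_eq_right h').symm
        ⟨a, ha, hI.leftPart ha h, hI.rightPart ha h'⟩ ⟨a, ha, hI, hI.leftPart ha h⟩
        ⟨a, ha, hI, hI.rightPart ha h'⟩ _ _
    · have e : I.leftPart k h = I := by
        ext
        · rfl
        · simp [NonemptyInterval.leftPart, (not_le.1 h').le]
      have : IsIso ((ofInHorn hI : SideCone H h₀ h₁ I).left h) := 
        H.isIso_hom (leftPart_le h) e (by rw [e]; exact hI)
      exact isLim_of_isIso_left _ h h'
  · have h' : k ≤ I.snd := (not_le.1 h).le.trans I.fst_le_snd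
    have e : I.rightPart k h' = I := by
      ext
      · simp [NonemptyInterval.rightPart, (not_le.1 h).le]
      · rfl
    have : IsIso ((ofInHorn hI : SideCone H h₀ h₁ I).right h') := 
      H.isIso_hom (rightPart_le h') e (by rw [e]; exact hI)
    exact isLim_of_isIso_right _ h h'

lemma isOver_ofInHorn_hom (h : J ≤ I) (h' : InHorn k I J) :
    (ofInHorn h'.left : SideCone H h₀ h₁ I).IsOver (ofInHorn h'.right) h (H.hom h h') := by
  obtain ⟨a, ha, hI, hJ⟩ := h'
  constructor
  · intro hk
    exact (H.hom_comp h (leftPart_le hk) ⟨a, ha, hI, hJ, hJ.leftPart ha hk⟩ ⟨a, ha, hI, hJ⟩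
      ⟨a, ha, hJ, hJ.leftPart ha hk⟩ ⟨a, ha, hI, hJ.leftPart ha hk⟩).trans
      (H.hom_comp (leftPart_le (h.1.trans hk)) (leftPart_mono h hk)
        ⟨a, ha, hI, hI.leftPart ha _, hJ.leftPart ha hk⟩ ⟨a, ha, hI, hI.leftPart ha _⟩ _ _).symm
  · intro hk
    exact (H.hom_comp h (rightPart_le hk) ⟨a, ha, hI, hJ, hJ.rightPart ha hk⟩ ⟨a, ha, hI, hJ⟩
      ⟨a, ha, hJ, hJ.rightPart ha hk⟩ ⟨a, ha, hI, hJ.rightPart ha hk⟩).trans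
      (H.hom_comp (rightPart_le (hk.trans h.2)) (rightPart_mono h hk)
        ⟨a, ha, hI, hI.rightPart ha _, hJ.rightPart ha hk⟩ ⟨a, ha, hI, hI.rightPart ha _⟩
        _ _).symm

end SideCone

end HornFamily

end Inner

section InnerFiller

variable {n : ℕ} {k : Fin (n + 1)}

namespace HornFamily

variable {C : Type u₁} [Category.{v₁} C] {H : HornFamily n k C} {h₀ : 0 < k}
  {h₁ : k < Fin.last n}

lemma hom_congr_right {I J J' : NonemptyInterval (Fin (n + 1))} (e : J = J') (h : J ≤ I)
    (h' : J' ≤ I) (w : InHorn k I J) (w' : InHorn k I J') :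
    H.hom h w = H.hom h' w' ≫ eqToHom (H.obj_congr e.symm _ _) := by
  subst e; simp

namespace SideCone

variable {I J : NonemptyInterval (Fin (n + 1))}

lemma IsLim.exists_iso {c c' : SideCone H h₀ h₁ I} (hc : c.IsLim) (hc' : c'.IsLim) :
    ∃ e : c.pt ≅ c'.pt, c.IsOver c' le_rfl e.hom := by
  obtain ⟨f, hf, -⟩ := hc' c
  obtain ⟨g, hg, -⟩ := hc c'
  exact ⟨⟨f, g, hc.hom_ext (hf.comp hg) c.isOver_id, hc'.hom_ext (hg.comp hf) c'.isOver_id⟩, hf⟩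

/-- The only condition with content concerns the right part of the left part. When it exists this is
`{k}`, and the condition becomes the commutativity `c.w`. -/
lemma isOver_left (c : SideCone H h₀ h₁ I) (h : I.fst ≤ k) :
    c.IsOver (ofInHorn (inHorn_of_snd_le h₁ (min_le_right _ _) (min_le_right _ _)))
      (leftPart_le h) (c.left h) := by
  refine ⟨fun _ => rfl, fun h' => ?_⟩
  have hk : k ≤ I.snd := (le_min_iff.1 h').1
  have e : (I.leftPart k h).rightPart k h' = pure k := by
    ext
    · simpa [NonemptyInterval.rightPart, NonemptyInterval.leftPart] using h
    · simpa [NonemptyInterval.rightPart, NonemptyInterval.leftPart] using hk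
  have e₁ := H.hom_congr_right e (rightPart_le h') (pure_le_leftPart h hk)
    (inHorn_of_snd_le h₁ (min_le_right _ _) (min_le_right _ _))
    (inHorn_of_snd_le h₁ (min_le_right _ _) le_rfl)
  have e₂ := H.hom_congr_right e (rightPart_mono (leftPart_le h) h') (pure_le_rightPart h hk)
    (inHorn_of_le_fst h₀ (le_max_right _ _) (le_max_right _ _))
    (inHorn_of_le_fst h₀ (le_max_right _ _) le_rfl)
  exact (congrArg (c.left h ≫ ·) e₁).trans (((reassoc_of% c.w h hk) _).trans
    (congrArg (c.right hk ≫ ·) e₂).symm)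

lemma isOver_right (c : SideCone H h₀ h₁ I) (h : k ≤ I.snd) :
    c.IsOver (ofInHorn (inHorn_of_le_fst h₀ (le_max_right _ _) (le_max_right _ _)))
      (rightPart_le h) (c.right h) := by
  refine ⟨fun h' => ?_, fun _ => rfl⟩
  have hk : I.fst ≤ k := (max_le_iff.1 h').1
  have e : (I.rightPart k h).leftPart k h' = pure k := by
    ext
    · simpa [NonemptyInterval.rightPart, NonemptyInterval.leftPart] using hk
    · simpa [NonemptyInterval.rightPart, NonemptyInterval.leftPart] using h
  have e₁ := H.hom_congr_right e (leftPart_le h') (pure_le_rightPart hk h)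
    (inHorn_of_le_fst h₀ (le_max_right _ _) (le_max_right _ _))
    (inHorn_of_le_fst h₀ (le_max_right _ _) le_rfl)
  have e₂ := H.hom_congr_right e (leftPart_mono (rightPart_le h) h') (pure_le_leftPart hk h)
    (inHorn_of_snd_le h₁ (min_le_right _ _) (min_le_right _ _))
    (inHorn_of_snd_le h₁ (min_le_right _ _) le_rfl)
  exact (congrArg (c.right h ≫ ·) e₁).trans (((reassoc_of% (c.w hk h).symm) _).trans
    (congrArg (c.left hk ≫ ·) e₂).symm)

end SideCone

/-- Pullback squares of the family give pullback squares of a functor that is isomorphic to it on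
the horn. -/
lemma isPullbackQuad_of_iso {G : IntervalCat (Fin (n + 1)) ⥤ C}
    (ε : ∀ (I) (hI : InHorn k I I), G.obj (toDual I) ≅ H.obj I hI)
    (hε : ∀ {I J} (h : J ≤ I) (h' : InHorn k I J),
      G.map (IntervalCat.res h) ≫ (ε J h'.right).hom = (ε I h'.left).hom ≫ H.hom h h')
    {i i' j' j : Fin (n + 1)} (h₁ : i ≤ i') (h₂ : i' ≤ j') (h₃ : j' ≤ j)
    (hh : ∃ a, a ≠ k ∧ i ≠ a ∧ i' ≠ a ∧ j' ≠ a ∧ j ≠ a) : IsPullbackQuad G h₁ h₂ h₃ := by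
  obtain ⟨a, ha, n₁, n₂, n₃, n₄⟩ := hh
  refine IsPullback.of_iso (H.isPullback_hom (L := IntervalCat.mk i j (h₁.trans (h₂.trans h₃)))
    (I := IntervalCat.mk i j' (h₁.trans h₂)) (J := IntervalCat.mk i' j (h₂.trans h₃))
    (K := IntervalCat.mk i' j' h₂) ⟨le_rfl, h₃⟩ ⟨h₁, le_rfl⟩ ⟨h₁, le_rfl⟩ ⟨le_rfl, h₃⟩ rfl rfl rfl
    rfl ⟨a, ha, ⟨n₁, n₃⟩, n₂, n₄⟩ ⟨a, ha, ⟨n₁, n₄⟩, n₁, n₃⟩ ⟨a, ha, ⟨n₁, n₄⟩, n₂, n₄⟩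
    ⟨a, ha, ⟨n₁, n₃⟩, n₂, n₃⟩ ⟨a, ha, ⟨n₂, n₄⟩, n₂, n₃⟩)
    (ε _ ⟨a, ha, ⟨n₁, n₄⟩, n₁, n₄⟩).symm (ε _ ⟨a, ha, ⟨n₁, n₃⟩, n₁, n₃⟩).symm
    (ε _ ⟨a, ha, ⟨n₂, n₄⟩, n₂, n₄⟩).symm (ε _ ⟨a, ha, ⟨n₂, n₃⟩, n₂, n₃⟩).symm ?_ ?_ ?_ ?_
  all_goals
    rw [Iso.symm_hom, Iso.symm_hom, Iso.eq_inv_comp, ← Category.assoc, Iso.comp_inv_eq, hε]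

variable (H) in
/-- Families on inner horns extend. -/
theorem exists_isFiller_inner [HasPullbacks C] (h₀ : 0 < k) (h₁ : k < Fin.last n) :
    ∃ G : IntervalCat (Fin (n + 1)) ⥤ C, H.IsFiller G ∧ PullbackProperty G := by
  choose c hc using SideCone.exists_isLim H h₀ h₁
  -- The chosen limit points form a functor because the maps over an inclusion exist and are unique.
  obtain ⟨m, hm, hid, hcomp⟩ := exists_functor_of_existsUnique (P := IntervalCat (Fin (n + 1)))
    (fun I => (c (ofDual I)).pt) (fun {I J} h f => (c (ofDual I)).IsOver (c (ofDual J)) h f)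
    (fun I => (c (ofDual I)).isOver_id) (fun _ _ _ _ hf hg => hf.comp hg)
    (fun {I J} h => ((hc (ofDual J)).existsUnique (c (ofDual I)) h).exists)
    (fun {I J} _ _ _ hf hg => (hc (ofDual J)).hom_ext hf hg)
  let G : IntervalCat (Fin (n + 1)) ⥤ C :=
    { obj I := (c (ofDual I)).pt
      map f := m (leOfHom f)
      map_id I := hid I
      map_comp f g := hcomp (leOfHom f) (leOfHom g) }
  have hG : ∀ {I J : NonemptyInterval (Fin (n + 1))} (h : J ≤ I),
      (c I).IsOver (c J) h (G.map (IntervalCat.res h)) := fun h => hm _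
  -- On the horn, the family and `G` are limits of the same diagram. Uniqueness also makes the
  -- resulting isomorphisms natural.
  have hε₀ : ∀ (I) (hI : InHorn k I I), ∃ e : G.obj (toDual I) ≅ H.obj I hI,
      (c I).IsOver (SideCone.ofInHorn hI) le_rfl e.hom := fun I hI =>
    (hc I).exists_iso (SideCone.isLim_ofInHorn hI)
  choose ε hε₁ using hε₀
  have hε : ∀ {I J} (h : J ≤ I) (h' : InHorn k I J),
      G.map (IntervalCat.res h) ≫ (ε J h'.right).hom = (ε I h'.left).hom ≫ H.hom h h' :=
    fun {I J} h h' => (SideCone.isLim_ofInHorn h'.right).hom_ext ((hG h).comp (hε₁ J _))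
      ((hε₁ I _).comp (SideCone.isOver_ofInHorn_hom h h'))
  have hPB : PullbackProperty G := by
    -- Squares on one side of `k` are transported from the face opposite the last vertex or `0`;
    -- only the squares divided at `k` need the limit cones.
    refine PullbackProperty.of_split k (fun i i' j' j w₁ w₂ w₃ hj => ?_)
      (fun i i' j' j w₁ w₂ w₃ hi => ?_) (fun i j hi hj => ?_)
    · exact isPullbackQuad_of_iso ε hε w₁ w₂ w₃ ⟨Fin.last n, h₁.ne',
        ((w₁.trans (w₂.trans (w₃.trans hj))).trans_lt h₁).ne,
        ((w₂.trans (w₃.trans hj)).trans_lt h₁).ne, ((w₃.trans hj).trans_lt h₁).ne,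
        (hj.trans_lt h₁).ne⟩
    · exact isPullbackQuad_of_iso ε hε w₁ w₂ w₃ ⟨0, h₀.ne, (h₀.trans_le hi).ne',
        (h₀.trans_le (hi.trans w₁)).ne', (h₀.trans_le (hi.trans (w₁.trans w₂))).ne',
        (h₀.trans_le (hi.trans (w₁.trans (w₂.trans w₃)))).ne'⟩
    -- The intervals are kept general because `[i, k]` and the left part of `[i, j]` agree only
    -- propositionally, the latter ending at a minimum.
    · have key : ∀ I J : NonemptyInterval (Fin (n + 1)),
          ∀ (hI : I ≤ IntervalCat.mk i j (hi.trans hj))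
          (hJ : J ≤ IntervalCat.mk i j (hi.trans hj)) (hI' : pure k ≤ I) (hJ' : pure k ≤ J),
          I = (IntervalCat.mk i j (hi.trans hj)).leftPart k hi →
          J = (IntervalCat.mk i j (hi.trans hj)).rightPart k hj →
          IsPullback (G.map (IntervalCat.res hI)) (G.map (IntervalCat.res hJ))
            (G.map (IntervalCat.res hI')) (G.map (IntervalCat.res hJ')) := by
        rintro _ _ hI hJ hI' hJ' rfl rfl
        refine IsPullback.of_iso ((hc (IntervalCat.mk i j (hi.trans hj))).isPullback hi hj)
          (Iso.refl _) (ε _ _).symm (ε _ _).symm (ε _ _).symm ?_ ?_ ?_ ?_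
        · refine ((Iso.comp_inv_eq _).2 ?_).trans (Category.id_comp _).symm
          exact (SideCone.isLim_ofInHorn _).hom_ext (SideCone.isOver_left _ hi)
            ((hG hI).comp (hε₁ _ _))
        · refine ((Iso.comp_inv_eq _).2 ?_).trans (Category.id_comp _).symm
          exact (SideCone.isLim_ofInHorn _).hom_ext (SideCone.isOver_right _ hj)
            ((hG hJ).comp (hε₁ _ _))
        · rw [Iso.symm_hom, Iso.symm_hom, Iso.eq_inv_comp, ← Category.assoc, Iso.comp_inv_eq]
          exact (hε hI' _).symm
        · rw [Iso.symm_hom, Iso.symm_hom, Iso.eq_inv_comp, ← Category.assoc, Iso.comp_inv_eq]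
          exact (hε hJ' _).symm
      refine key _ _ _ _ _ _ ?_ ?_
      · ext
        · rfl
        · simpa [NonemptyInterval.leftPart] using hj
      · ext
        · simpa [NonemptyInterval.rightPart] using hi
        · rfl
  obtain ⟨G', hG', α, hPB', -⟩ := exists_isFiller_of_iso hPB ε hε
  exact ⟨G', hG', hPB'⟩

end HornFamily

end InnerFiller

/-! ### Uniqueness of inner fillers and lifts over given codomains -/

section InnerLift

lemma PullbackProperty.isPullback {α : Type} [LinearOrder α] {C : Type u₁} [Category.{v₁} C]
    {F : IntervalCat α ⥤ C} (hF : PullbackProperty F) {L I J K : NonemptyInterval α}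
    (hI : I ≤ L) (hJ : J ≤ L) (hKI : K ≤ I) (hKJ : K ≤ J) (e₁ : I.fst = L.fst)
    (e₂ : J.snd = L.snd) (e₃ : K.fst = J.fst) (e₄ : K.snd = I.snd) :
    IsPullback (F.map (IntervalCat.res hI)) (F.map (IntervalCat.res hJ))
      (F.map (IntervalCat.res hKI)) (F.map (IntervalCat.res hKJ)) := by
  obtain ⟨⟨i, j⟩, hL⟩ := L
  obtain ⟨⟨_, j'⟩, hI'⟩ := I
  obtain ⟨⟨i', _⟩, hJ'⟩ := J
  obtain ⟨⟨_, _⟩, hK'⟩ := K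
  dsimp only at e₁ e₂ e₃ e₄ hL hI' hJ' hK'
  subst e₁ e₂ e₃ e₄
  exact hF.isPullbackQuad hJ.1 hK' hI.2

lemma IntervalCat.isIso_map_res {α : Type} [LinearOrder α] {C : Type u₁} [Category.{v₁} C]
    (F : IntervalCat α ⥤ C) {I J : NonemptyInterval α} (h : J ≤ I) (e : J = I) :
    IsIso (F.map (res h)) := by
  subst e; infer_instance

namespace HornFamily

variable {n : ℕ} {k : Fin (n + 1)} {C : Type u₁} [Category.{v₁} C] {H : HornFamily n k C}
  {X : IntervalCat (Fin (n + 1)) ⥤ C}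

lemma IsFiller.map_comp_hom (hX : H.IsFiller X) {L I J : NonemptyInterval (Fin (n + 1))}
    (h : I ≤ L) (h' : J ≤ I) (w : InHorn k I J) :
    (X.map (IntervalCat.res h) ≫ eqToHom (hX.obj_eq I w.left)) ≫ H.hom h' w =
      X.map (IntervalCat.res (h'.trans h)) ≫ eqToHom (hX.obj_eq J w.right) := by
  rw [← IntervalCat.map_res_comp X h h', hX.map_eq h' w]
  simp

namespace SideCone

variable {h₀ : 0 < k} {h₁ : k < Fin.last n} {I J : NonemptyInterval (Fin (n + 1))}

/-- The cone given by a filler of the family. -/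
def ofIsFiller (hX : H.IsFiller X) (I : NonemptyInterval (Fin (n + 1))) :
    SideCone H h₀ h₁ I where
  pt := X.obj (toDual I)
  left h := X.map (IntervalCat.res (leftPart_le h)) ≫ eqToHom (hX.obj_eq _ _)
  right h := X.map (IntervalCat.res (rightPart_le h)) ≫ eqToHom (hX.obj_eq _ _)
  w _ _ := (hX.map_comp_hom _ _ _).trans (hX.map_comp_hom _ _ _).symm

lemma isOver_map (hX : H.IsFiller X) (h : J ≤ I) :
    (ofIsFiller hX I : SideCone H h₀ h₁ I).IsOver (ofIsFiller hX J) h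
      (X.map (IntervalCat.res h)) := by
  refine ⟨fun hJ => ?_, fun hJ => ?_⟩
  · refine Eq.trans ?_ (hX.map_comp_hom (leftPart_le (h.1.trans hJ)) (leftPart_mono h hJ)
      (inHorn_of_snd_le h₁ (min_le_right _ _) (min_le_right _ _))).symm
    simp [ofIsFiller, ← IntervalCat.map_res_comp X h (leftPart_le hJ)]
  · refine Eq.trans ?_ (hX.map_comp_hom (rightPart_le (hJ.trans h.2)) (rightPart_mono h hJ)
      (inHorn_of_le_fst h₀ (le_max_right _ _) (le_max_right _ _))).symm
    simp [ofIsFiller, ← IntervalCat.map_res_comp X h (rightPart_le hJ)]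

/-- This is the pullback property of `X` for the square dividing `I` at `k`; the one-sided cases are
isomorphisms. -/
lemma isLim_ofIsFiller (hX : H.IsFiller X) (hX' : PullbackProperty X)
    (I : NonemptyInterval (Fin (n + 1))) : (ofIsFiller hX I : SideCone H h₀ h₁ I).IsLim := by
  by_cases h : I.fst ≤ k
  · by_cases h' : k ≤ I.snd
    · refine isLim_of_isPullback _ h h' ?_
      refine IsPullback.of_iso (hX'.isPullback (leftPart_le h) (rightPart_le h')
        (pure_le_leftPart h h') (pure_le_rightPart h h') rfl rfl (max_eq_right h).symm
        (min_eq_right h').symm) (Iso.refl _) (eqToIso (hX.obj_eq _ _)) (eqToIso (hX.obj_eq _ _))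
        (eqToIso (hX.obj_eq _ (inHorn_of_snd_le h₁ le_rfl le_rfl))) ?_ ?_ ?_ ?_
      · exact (Category.id_comp _).symm
      · exact (Category.id_comp _).symm
      · rw [hX.map_eq (pure_le_leftPart h h') (inHorn_of_snd_le h₁ (min_le_right _ _) le_rfl)]
        simp [homLK]
      · rw [hX.map_eq (pure_le_rightPart h h') (inHorn_of_le_fst h₀ (le_max_right _ _) le_rfl)]
        simp [homRK]
    · have e : I.leftPart k h = I := by
        ext
        · rfl
        · simp [NonemptyInterval.leftPart, (not_le.1 h').le]
      have : IsIso ((ofIsFiller hX I : SideCone H h₀ h₁ I).left h) := by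
        have := IntervalCat.isIso_map_res X (leftPart_le h) e
        dsimp only [ofIsFiller]
        infer_instance
      exact isLim_of_isIso_left _ h h'
  · have h' : k ≤ I.snd := (not_le.1 h).le.trans I.fst_le_snd
    have e : I.rightPart k h' = I := by
      ext
      · simp [NonemptyInterval.rightPart, (not_le.1 h).le]
      · rfl
    have : IsIso ((ofIsFiller hX I : SideCone H h₀ h₁ I).right h') := by
      have := IntervalCat.isIso_map_res X (rightPart_le h') e
      dsimp only [ofIsFiller]
      infer_instance
    exact isLim_of_isIso_right _ h h'

/-- Uniqueness of maps into a limit cone then forces the comparison of two fillers to be the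
transport on the horn. -/
lemma isOver_eqToHom {X' : IntervalCat (Fin (n + 1)) ⥤ C} (hX : H.IsFiller X)
    (hX' : H.IsFiller X') (hI : InHorn k I I) :
    (ofIsFiller hX I : SideCone H h₀ h₁ I).IsOver (ofIsFiller hX' I) le_rfl
      (eqToHom ((hX.obj_eq I hI).trans (hX'.obj_eq I hI).symm)) := by
  obtain ⟨a, ha, hI', -⟩ := hI
  refine ⟨fun h => ?_, fun h => ?_⟩
  · rw [homL_self]
    simp only [ofIsFiller]
    rw [hX.map_eq (leftPart_le h) ⟨a, ha, hI', hI'.leftPart ha h⟩,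
      hX'.map_eq (leftPart_le h) ⟨a, ha, hI', hI'.leftPart ha h⟩]
    simp only [Category.assoc, eqToHom_trans, eqToHom_refl, Category.comp_id]
    exact eqToHom_trans_assoc _ _ _
  · rw [homR_self]
    simp only [ofIsFiller]
    rw [hX.map_eq (rightPart_le h) ⟨a, ha, hI', hI'.rightPart ha h⟩,
      hX'.map_eq (rightPart_le h) ⟨a, ha, hI', hI'.rightPart ha h⟩]
    simp only [Category.assoc, eqToHom_trans, eqToHom_refl, Category.comp_id]
    exact eqToHom_trans_assoc _ _ _

end SideCone

/-- Two fillers of a family on an inner horn are isomorphic relative to the horn. -/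
lemma exists_iso_of_isFiller {X' : IntervalCat (Fin (n + 1)) ⥤ C} (h₀ : 0 < k)
    (h₁ : k < Fin.last n) (hX : H.IsFiller X) (hX' : H.IsFiller X') (hPX : PullbackProperty X)
    (hPX' : PullbackProperty X') :
    ∃ κ : X ≅ X', ∀ (I) (hI : InHorn k I I), κ.hom.app (toDual I) =
      eqToHom ((hX.obj_eq I hI).trans (hX'.obj_eq I hI).symm) := by
  choose e he using fun I => (SideCone.isLim_ofIsFiller (h₀ := h₀) (h₁ := h₁) hX hPX I).exists_iso
    (SideCone.isLim_ofIsFiller hX' hPX' I)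
  refine ⟨NatIso.ofComponents (fun I => e (ofDual I)) ?_, fun I hI => ?_⟩
  · intro I J f
    rw [IntervalCat.eq_res f]
    exact (SideCone.isLim_ofIsFiller hX' hPX' (ofDual J)).hom_ext
      ((SideCone.isOver_map hX _).comp (he (ofDual J)))
      ((he (ofDual I)).comp (SideCone.isOver_map hX' _))
  · exact (SideCone.isLim_ofIsFiller hX' hPX' I).hom_ext (he I)
      (SideCone.isOver_eqToHom hX hX' hI)

lemma exists_isoMk_refl_hom_eq_eqToHom (A : Arrow C) {B : C} (κ : A.right ≅ B)
    (h : A.right = B) (hκ : κ.hom = eqToHom h) :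
    ∃ e : A = Arrow.mk (A.hom ≫ κ.hom), (Arrow.isoMk (f := A) (g := Arrow.mk (A.hom ≫ κ.hom))
      (Iso.refl _) κ (by simp)).hom = eqToHom e := by
  subst h
  obtain rfl : κ = Iso.refl _ := by ext; simpa using hκ
  have e : A = Arrow.mk (A.hom ≫ 𝟙 _) := by rw [Category.comp_id]; rfl
  refine ⟨e, ?_⟩
  ext <;> simp [Arrow.eqToHom_left, Arrow.eqToHom_right]

/-- Families of arrows on inner horns extend over a given extension of the codomains. -/
theorem exists_isFiller_inner_over (H : HornFamily n k (Arrow C)) [HasPullbacks (Arrow C)]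
    [PreservesLimitsOfShape WalkingCospan (Arrow.rightFunc : Arrow C ⥤ C)]
    (h₀ : 0 < k) (h₁ : k < Fin.last n) (hX : (H.postcomp Arrow.rightFunc).IsFiller X)
    (hPX : PullbackProperty X) :
    ∃ G : IntervalCat (Fin (n + 1)) ⥤ Arrow C,
      H.IsFiller G ∧ PullbackProperty G ∧ G ⋙ Arrow.rightFunc = X := by
  obtain ⟨G, hG, hPG⟩ := H.exists_isFiller_inner h₀ h₁
  obtain ⟨κ, hκ⟩ := exists_iso_of_isFiller h₀ h₁ (hG.postcomp Arrow.rightFunc) hX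
    (hPG.postcomp _) hPX
  -- Domains stay fixed and each arrow is composed with `κ`. On the horn `κ` is a transport, so the
  -- strict filling condition survives.
  let e : ∀ I, G.obj I ≅ Arrow.mk ((G.obj I).hom ≫ κ.hom.app I) := fun I =>
    Arrow.isoMk (Iso.refl _) (κ.app I) (by simp)
  refine ⟨G.copyObj _ e, ?_, hPG.of_iso (G.isoCopyObj _ e), ?_⟩
  · intro m x hx
    rw [← hG x hx]
    refine (NatIso.functor_eq_of_app_eq_eqToHom
      (Functor.isoWhiskerLeft (IntervalCat.functor x) (G.isoCopyObj _ e)) fun I => ?_).symm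
    exact exists_isoMk_refl_hom_eq_eqToHom _ (κ.app _) _ (hκ _ (inHorn_map hx (ofDual I) _))
  · refine NatIso.functor_eq_of_app_eq_eqToHom (NatIso.ofComponents (fun _ => Iso.refl _) ?_)
      fun I => ⟨rfl, rfl⟩
    intro I J f
    have := κ.hom.naturality f
    refine (Category.comp_id _).trans (Eq.trans ?_ (Category.id_comp _).symm)
    exact (Iso.inv_comp_eq (κ.app I)).2 this

end HornFamily

end InnerLift

/-! ### Horns in `Span(C)` as horn families -/

section HornMaps

set_option linter.checkUnivs false

namespace HornFamily

variable {n : ℕ} {k : Fin (n + 1)} {C : Type u₁} [Category.{v₁} C]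

lemma mem_horn {m : ℕ} (x : Fin (m + 1) →o Fin (n + 1)) (hx : Misses k x) :
    SSet.stdSimplex.objEquiv.{max u₁ v₁}.symm (SimplexCategory.Hom.mk x) ∈
      (SSet.horn.{max u₁ v₁} n k).obj (op ⦋m⦌) := by
  rw [SSet.mem_horn_iff_notMem_range]
  obtain ⟨a, ha, h⟩ := hx
  exact ⟨a, ha, by rintro ⟨i, hi⟩; exact h i hi⟩

/-- The simplex of the horn given by a monotone map. -/
def hornSimplex {m : ℕ} (x : Fin (m + 1) →o Fin (n + 1)) (hx : Misses k x) :
    (SSet.horn.{max u₁ v₁} n k : SSet.{max u₁ v₁}) _⦋m⦌ :=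
  ⟨SSet.stdSimplex.objEquiv.{max u₁ v₁}.symm (SimplexCategory.Hom.mk x), mem_horn.{v₁, u₁} x hx⟩

/-- The family of span diagrams given by a horn in `Span(C)`. -/
def ofHorn (s : (SSet.horn.{max u₁ v₁} n k : SSet.{max u₁ v₁}) ⟶ Span C) : HornFamily n k C where
  cell x hx := Span.diagram (s.app _ (hornSimplex.{v₁, u₁} x hx))
  pullbackProperty x hx := (s.app _ (hornSimplex.{v₁, u₁} x hx)).2
  cell_comp {m l} x y hx hxy := by
    have h := NatTrans.naturality_apply s (SimplexCategory.mkHom y).op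
      (hornSimplex.{v₁, u₁} x hx)
    exact congrArg Subtype.val h

lemma exists_eq_hornSimplex {m : SimplexCategoryᵒᵖ}
    (z : (SSet.horn.{max u₁ v₁} n k : SSet.{max u₁ v₁}).obj m) :
    ∃ (x : Fin (m.unop.len + 1) →o Fin (n + 1)) (hx : Misses k x),
      z = hornSimplex.{v₁, u₁} x hx := by
  obtain ⟨z, hz⟩ := z
  obtain ⟨f, rfl⟩ := SSet.stdSimplex.objEquiv.symm.surjective z
  have := (SSet.mem_horn_iff_notMem_range (d := m.unop.len) _ _).1 hz
  obtain ⟨a, ha, h⟩ := this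
  exact ⟨f.toOrderHom, ⟨a, ha, fun i hi => h ⟨i, hi⟩⟩, rfl⟩

/-- A filler of the family of a horn gives an extension of the horn. -/
lemma ι_comp_of_isFiller (s : (SSet.horn.{max u₁ v₁} n k : SSet.{max u₁ v₁}) ⟶ Span C)
    {G : IntervalCat (Fin (n + 1)) ⥤ C} (hG : (ofHorn s).IsFiller G) (hPG : PullbackProperty G) :
    (SSet.horn.{max u₁ v₁} n k).ι ≫ (SSet.yonedaEquiv (X := Span C) (n := ⦋n⦌)).symm ⟨G, hPG⟩ =
      s := by
  ext m z
  obtain ⟨x, hx, rfl⟩ := exists_eq_hornSimplex.{v₁, u₁} z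
  exact Subtype.ext (hG x hx)

lemma isFiller_of_ι_comp (s : (SSet.horn.{max u₁ v₁} n k : SSet.{max u₁ v₁}) ⟶ Span C)
    (t : (Δ[n] : SSet.{max u₁ v₁}) ⟶ Span C) (h : (SSet.horn.{max u₁ v₁} n k).ι ≫ t = s) :
    (ofHorn s).IsFiller (Span.diagram (SSet.yonedaEquiv t)) := by
  subst h
  intro m x hx
  have := SSet.yonedaEquiv.symm_apply_apply t
  conv_rhs => rw [← this]
  rfl

end HornFamily

open HornFamily

instance quasicategory_span (C : Type u₁) [Category.{v₁} C] [HasPullbacks C] :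
    SSet.Quasicategory (Span C) where
  hornFilling' n k s h₀ h₁ := by
    obtain ⟨G, hG, hPG⟩ := (ofHorn s).exists_isFiller_inner h₀ h₁
    exact ⟨_, (ι_comp_of_isFiller s hG hPG).symm⟩

lemma innerFibration_codSpan : SSet.InnerFibration codSpan.{u} := by
  refine ⟨?_⟩
  rintro _ _ _ ⟨k, h₀, h₁⟩
  refine ⟨fun {s t} sq => ?_⟩
  have ht : (ofHorn (s ≫ codSpan)).IsFiller _ := fun x hx =>
    isFiller_of_ι_comp _ t sq.w.symm x hx
  obtain ⟨G, hG, hPG, e⟩ := exists_isFiller_inner_over (ofHorn s) h₀ h₁ ht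
    (SSet.yonedaEquiv t).2
  refine ⟨⟨⟨_, ι_comp_of_isFiller s hG hPG, ?_⟩⟩⟩
  apply SSet.yonedaEquiv.injective
  refine Subtype.ext (Eq.trans ?_ e)
  rfl

end HornMaps

/-! ### Outer horns -/

section Outer

lemma CategoryTheory.Arrow.isPullback {C : Type u₁} [Category.{v₁} C] {P A B Z : Arrow C}
    {f : P ⟶ A} {g : P ⟶ B} {h : A ⟶ Z} {i : B ⟶ Z}
    (hl : IsPullback f.left g.left h.left i.left)
    (hr : IsPullback f.right g.right h.right i.right) : IsPullback f g h i := by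
  have wl (s : PullbackCone h i) : s.fst.left ≫ h.left = s.snd.left ≫ i.left :=
    congrArg (fun φ => φ.left) s.condition
  have wr (s : PullbackCone h i) : s.fst.right ≫ h.right = s.snd.right ≫ i.right :=
    congrArg (fun φ => φ.right) s.condition
  refine ⟨⟨Arrow.hom_ext _ _ hl.w hr.w⟩, ⟨PullbackCone.IsLimit.mk _ (fun s => Arrow.homMk
    (hl.lift s.fst.left s.snd.left (wl s)) (hr.lift s.fst.right s.snd.right (wr s))
    (hr.hom_ext ?_ ?_)) (fun s => ?_) (fun s => ?_) fun s m hm hm' => ?_⟩⟩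
  · rw [Category.assoc, Category.assoc, ← Arrow.w f, hl.lift_fst_assoc]
    exact (Arrow.w s.fst).trans (congrArg (_ ≫ ·) (hr.lift_fst _ _ (wr s)).symm)
  · rw [Category.assoc, Category.assoc, ← Arrow.w g, hl.lift_snd_assoc]
    exact (Arrow.w s.snd).trans (congrArg (_ ≫ ·) (hr.lift_snd _ _ (wr s)).symm)
  · exact Arrow.hom_ext _ _ (hl.lift_fst _ _ _) (hr.lift_fst _ _ _)
  · exact Arrow.hom_ext _ _ (hl.lift_snd _ _ _) (hr.lift_snd _ _ _)
  · refine Arrow.hom_ext _ _ (hl.hom_ext ?_ ?_) (hr.hom_ext ?_ ?_)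
    · exact (congrArg (fun φ => φ.left) hm).trans (hl.lift_fst _ _ _).symm
    · exact (congrArg (fun φ => φ.left) hm').trans (hl.lift_snd _ _ _).symm
    · exact (congrArg (fun φ => φ.right) hm).trans (hr.lift_fst _ _ _).symm
    · exact (congrArg (fun φ => φ.right) hm').trans (hr.lift_snd _ _ _).symm

namespace HornFamily

section

variable {n : ℕ} {k : Fin (n + 1)} {C : Type u₁} [Category.{v₁} C] {D : Type u₂} [Category.{v₂} D]

lemma postcomp_hom (H : HornFamily n k C) (P : C ⥤ D) [PreservesLimitsOfShape WalkingCospan P]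
    {I J : NonemptyInterval (Fin (n + 1))} (h : J ≤ I) (h' : InHorn k I J) :
    (H.postcomp P).hom h h' = P.map (H.hom h h') := by
  simp only [hom, Functor.map_comp, eqToHom_map]
  rfl

variable (H : HornFamily n k (Arrow C))

lemma hom_left_comp {L I J : NonemptyInterval (Fin (n + 1))} (h : I ≤ L) (h' : J ≤ I)
    (hh : ∃ a, a ≠ k ∧ Avoids a L ∧ Avoids a I ∧ Avoids a J) (hLI : InHorn k L I)
    (hIJ : InHorn k I J) (hLJ : InHorn k L J) :
    (H.hom h hLI).left ≫ (H.hom h' hIJ).left = (H.hom (h'.trans h) hLJ).left := by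
  rw [← H.hom_comp h h' hh hLI hIJ hLJ]
  rfl

lemma hom_left_self (I : NonemptyInterval (Fin (n + 1))) (h : InHorn k I I) :
    (H.hom le_rfl h).left = 𝟙 _ := by
  rw [hom_self]
  rfl

variable [PreservesLimitsOfShape WalkingCospan (Arrow.rightFunc : Arrow C ⥤ C)]
  {X : IntervalCat (Fin (n + 1)) ⥤ C} (hX : (H.postcomp Arrow.rightFunc).IsFiller X)

lemma map_eq_right (hX : (H.postcomp Arrow.rightFunc).IsFiller X)
    {I J : NonemptyInterval (Fin (n + 1))} (h : J ≤ I) (h' : InHorn k I J) :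
    X.map (IntervalCat.res h) = eqToHom (hX.obj_eq I h'.left) ≫ (H.hom h h').right ≫
      eqToHom (hX.obj_eq J h'.right).symm := by
  rw [hX.map_eq h h', postcomp_hom]
  rfl

/-- The objects of the family, as arrows to the values of a filler of the codomains. -/
def toBase (I : NonemptyInterval (Fin (n + 1))) (hI : InHorn k I I) :
    (H.obj I hI).left ⟶ X.obj (toDual I) :=
  (H.obj I hI).hom ≫ eqToHom (hX.obj_eq I hI).symm

lemma hom_left_toBase {I J : NonemptyInterval (Fin (n + 1))} (h : J ≤ I) (h' : InHorn k I J) :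
    (H.hom h h').left ≫ H.toBase hX J h'.right =
      H.toBase hX I h'.left ≫ X.map (IntervalCat.res h) := by
  unfold toBase
  rw [H.map_eq_right hX h h', Arrow.w_assoc, Category.assoc]
  exact congrArg ((H.obj I h'.left).hom ≫ ·)
    ((eqToHom_trans_assoc _ _ _).trans (Category.id_comp _)).symm

end

end HornFamily

/-- An edge of `Span(Arr(C))` whose left leg has an invertible upper part and whose right square
is a pullback. -/
structure IsIsoThenPullback {C : Type u₁} [Category.{v₁} C]
    (F : IntervalCat (Fin 2) ⥤ Arrow C) : Prop where
  isIso : IsIso (F.map (IntervalCat.res int0_le)).left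
  isPullback : IsPullback (F.map (IntervalCat.res int1_le)).left (F.obj (toDual int01)).hom
    (F.obj (toDual int1)).hom (F.map (IntervalCat.res int1_le)).right

/-! ### Replacing the right endpoint `t` by the last vertex -/

section Stretch

variable {n : ℕ} {t : Fin (n + 1)}

/-- Move the right endpoint `t` of an interval to the last vertex. -/
def NonemptyInterval.stretch (t : Fin (n + 1)) (I : NonemptyInterval (Fin (n + 1))) :
    NonemptyInterval (Fin (n + 1)) :=
  ⟨(I.fst, if I.snd = t then Fin.last n else I.snd), by
    split_ifs
    exacts [Fin.le_last _, I.fst_le_snd]⟩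

lemma le_stretch (I : NonemptyInterval (Fin (n + 1))) : I ≤ I.stretch t :=
  ⟨le_rfl, by
    dsimp only [NonemptyInterval.stretch]
    split_ifs
    exacts [Fin.le_last _, le_rfl]⟩

lemma stretch_snd_ne (htN : t < Fin.last n) (I : NonemptyInterval (Fin (n + 1))) :
    (I.stretch t).snd ≠ t := by
  dsimp only [NonemptyInterval.stretch]
  split_ifs with h
  exacts [htN.ne', h]

lemma stretch_eq_self {I : NonemptyInterval (Fin (n + 1))} (h : I.snd ≠ t) : I.stretch t = I := by
  ext
  · rfl
  · simp [NonemptyInterval.stretch, h]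

lemma stretch_snd_eq_last (ht : ∀ a, t < a → a = Fin.last n)
    {I : NonemptyInterval (Fin (n + 1))} (h : t ≤ I.snd) : (I.stretch t).snd = Fin.last n := by
  dsimp only [NonemptyInterval.stretch]
  split_ifs with h'
  exacts [rfl, ht _ (h.lt_of_ne' h')]

/-- Monotonicity needs `t` to have no successor but the last vertex: if `J` ends at `t` and `I` ends
later, then `I` already ends there. -/
lemma stretch_mono (ht : ∀ a, t < a → a = Fin.last n) {I J : NonemptyInterval (Fin (n + 1))}
    (h : J ≤ I) : J.stretch t ≤ I.stretch t := by
  refine ⟨h.1, ?_⟩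
  dsimp only [NonemptyInterval.stretch]
  split_ifs with h₁ h₂ h₂
  · exact le_rfl
  · exact (ht _ ((h₁.symm.trans_le h.2).lt_of_ne' h₂)).ge
  · exact Fin.le_last _
  · exact h.2

lemma Avoids.stretch {a : Fin (n + 1)} (ha : a ≠ Fin.last n) {I : NonemptyInterval (Fin (n + 1))}
    (h : Avoids a I) : Avoids a (I.stretch t) := by
  refine ⟨h.1, ?_⟩
  dsimp only [NonemptyInterval.stretch]
  split_ifs
  exacts [ha.symm, h.2]

/-- An interval that does not end with `t` has a vertex
that it avoids together with all subintervals that avoid `t`. -/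
lemma exists_avoids (h₀ : 0 < t) (htN : t < Fin.last n)
    {P : NonemptyInterval (Fin (n + 1))} (hP : P.snd ≠ t) :
    ∃ a, a ≠ Fin.last n ∧ Avoids a P ∧ ∀ Z ≤ P, Avoids t Z → Avoids a Z := by
  -- An interval that starts at `t` misses `0`, as do its subintervals; any other `P` avoids `t`
  -- itself.
  by_cases h : P.fst = t
  · refine ⟨0, (h₀.trans htN).ne, ⟨h.trans_ne h₀.ne', ?_⟩, fun Z hZ _ => ?_⟩
    · exact ((h₀.trans_le h.ge).trans_le P.fst_le_snd).ne'
    · exact ⟨((h₀.trans_le h.ge).trans_le hZ.1).ne',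
        ((h₀.trans_le h.ge).trans_le (hZ.1.trans Z.fst_le_snd)).ne'⟩
  · exact ⟨t, htN.ne, ⟨h, hP⟩, fun Z _ hZ => hZ⟩

lemma eq_pure_last (ht : ∀ a, t < a → a = Fin.last n) {Z : NonemptyInterval (Fin (n + 1))}
    (h : t ≤ Z.fst) (hZ : Avoids t Z) : Z = pure (Fin.last n) := by
  have h₁ := ht _ (h.lt_of_ne' hZ.1)
  ext1
  refine Prod.ext h₁ ?_
  exact Fin.last_le_iff.1 (h₁.ge.trans Z.fst_le_snd)

end Stretch

end Outer

/-! ### Outer horns over given codomains -/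

section OuterFiller

namespace HornFamily

variable {n : ℕ} {t : Fin (n + 1)}

lemma inHorn_of_snd_ne (h₀ : 0 < t) (htN : t < Fin.last n) {P : NonemptyInterval (Fin (n + 1))}
    (hP : P.snd ≠ t) : InHorn (Fin.last n) P P :=
  let ⟨a, ha, h, _⟩ := exists_avoids h₀ htN hP
  ⟨a, ha, h, h⟩

lemma inHorn_of_avoids (h₀ : 0 < t) (htN : t < Fin.last n) {P Z : NonemptyInterval (Fin (n + 1))}
    (hP : P.snd ≠ t) (h : Z ≤ P) (hZ : Avoids t Z) : InHorn (Fin.last n) P Z :=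
  let ⟨a, ha, h', h''⟩ := exists_avoids h₀ htN hP
  ⟨a, ha, h', h'' Z h hZ⟩

variable (htN : t < Fin.last n)

/-- The interval from `t` to the last vertex. -/
abbrev lastEdge : NonemptyInterval (Fin (n + 1)) := IntervalCat.mk t (Fin.last n) htN.le

lemma pure_last_le_lastEdge : pure (Fin.last n) ≤ lastEdge htN := ⟨htN.le, le_rfl⟩

lemma pure_le_lastEdge : pure t ≤ lastEdge htN := ⟨le_rfl, htN.le⟩

lemma inHorn_lastEdge (h₀ : 0 < t) : InHorn (Fin.last n) (lastEdge htN) (lastEdge htN) :=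
  inHorn_of_snd_ne h₀ htN htN.ne'

lemma inHorn_lastEdge_last (h₀ : 0 < t) :
    InHorn (Fin.last n) (lastEdge htN) (pure (Fin.last n)) :=
  inHorn_of_avoids h₀ htN htN.ne' (pure_last_le_lastEdge htN) ⟨htN.ne', htN.ne'⟩

lemma inHorn_lastEdge_pure (h₀ : 0 < t) : InHorn (Fin.last n) (lastEdge htN) (pure t) :=
  ⟨0, (h₀.trans htN).ne, ⟨h₀.ne', (h₀.trans htN).ne'⟩, h₀.ne', h₀.ne'⟩

variable {htN} {C : Type u₁} [Category.{v₁} C] {H : HornFamily n (Fin.last n) (Arrow C)}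

lemma isIso_hom_left (h₀ : 0 < t)
    (hc : IsIsoThenPullback (H.cell _ (misses_edge (inHorn_lastEdge htN h₀)))) :
    IsIso (H.hom (pure_le_lastEdge htN) (inHorn_lastEdge_pure htN h₀)).left := by
  have e := H.cell_map (edge (lastEdge htN)) (misses_edge (inHorn_lastEdge htN h₀)) int0_le
  let α := eqToIso (H.cell_obj (edge (lastEdge htN)) (misses_edge (inHorn_lastEdge htN h₀)) int01)
  let β := eqToIso (H.cell_obj (edge (lastEdge htN)) (misses_edge (inHorn_lastEdge htN h₀)) int0)
  have e' := congrArg (fun φ => φ.left) ((Iso.eq_inv_comp α).2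
    ((Iso.eq_comp_inv β).1 (e.trans (Category.assoc _ _ _).symm)).symm)
  exact (congrArg (fun φ => IsIso φ) e').mpr (IsIso.comp_isIso'
    (inferInstanceAs (IsIso (Arrow.leftFunc.mapIso α).inv)) (IsIso.comp_isIso' hc.isIso
      (inferInstanceAs (IsIso (Arrow.leftFunc.mapIso β).hom))))

variable [PreservesLimitsOfShape WalkingCospan (Arrow.rightFunc : Arrow C ⥤ C)]
  {X : IntervalCat (Fin (n + 1)) ⥤ C} {hX : (H.postcomp Arrow.rightFunc).IsFiller X}

variable (t hX) in
/-- The condition on a map between values of the family at intervals `Q ≤ P` to be compatible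
with the maps of the family to intervals that avoid `t` and with the codomains. -/
def IsStretchMap {P Q : NonemptyInterval (Fin (n + 1))} (hP : InHorn (Fin.last n) P P)
    (hQ : InHorn (Fin.last n) Q Q) (h : Q ≤ P) (f : (H.obj P hP).left ⟶ (H.obj Q hQ).left) :
    Prop :=
  f ≫ H.toBase hX Q hQ = H.toBase hX P hP ≫ X.map (IntervalCat.res h) ∧
  ∀ Z (hZ : Z ≤ Q) (w : InHorn (Fin.last n) Q Z) (w' : InHorn (Fin.last n) P Z), Avoids t Z →
    f ≫ (H.hom hZ w).left = (H.hom (hZ.trans h) w').left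

lemma isStretchMap_id {P : NonemptyInterval (Fin (n + 1))} (hP : InHorn (Fin.last n) P P) :
    IsStretchMap t hX hP hP le_rfl (𝟙 _) :=
  ⟨by rw [IntervalCat.map_res_self, Category.id_comp, Category.comp_id],
    fun _ _ _ _ _ => Category.id_comp _⟩

lemma IsStretchMap.comp {L P Q : NonemptyInterval (Fin (n + 1))} {hL : InHorn (Fin.last n) L L}
    {hP : InHorn (Fin.last n) P P} {hQ : InHorn (Fin.last n) Q Q} {h : P ≤ L} {h' : Q ≤ P}
    {f : (H.obj L hL).left ⟶ (H.obj P hP).left} {g : (H.obj P hP).left ⟶ (H.obj Q hQ).left}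
    (hf : IsStretchMap t hX hL hP h f) (hg : IsStretchMap t hX hP hQ h' g)
    (hPt : ∀ Z ≤ P, Avoids t Z → InHorn (Fin.last n) P Z) :
    IsStretchMap t hX hL hQ (h'.trans h) (f ≫ g) := by
  refine ⟨?_, fun Z hZ w w' hZt => ?_⟩
  · rw [Category.assoc, hg.1, reassoc_of% hf.1, IntervalCat.map_res_comp]
  · have hPZ := hPt Z (hZ.trans h') hZt
    rw [Category.assoc, hg.2 Z hZ w hPZ hZt, hf.2 Z (hZ.trans h') hPZ w' hZt]

/-- The maps of the family are compatible. -/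
lemma isStretchMap_hom (h₀ : 0 < t) (htN : t < Fin.last n) (ht : ∀ a, t < a → a = Fin.last n)
    {P Q : NonemptyInterval (Fin (n + 1))} (hP : P.snd ≠ t) (hQ : Q.snd ≠ t)
    (h : Q ≤ P) (w : InHorn (Fin.last n) P Q) :
    IsStretchMap t hX w.left w.right h (H.hom h w).left := by
  refine ⟨H.hom_left_toBase hX h w, fun Z hZ w₁ w₂ hZt => ?_⟩
  refine H.hom_left_comp h hZ ?_ _ _ _
  -- If `Q` starts at `t`, then `Z` is the last vertex alone and is avoided by the vertex that `w`
  -- provides. Otherwise `Q` avoids `t` and `exists_avoids` applies.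
  by_cases hQt : Q.fst = t
  · obtain rfl := eq_pure_last ht (hQt.ge.trans hZ.1) hZt
    obtain ⟨a, ha, haP, haQ⟩ := w
    exact ⟨a, ha, haP, haQ, ha.symm, ha.symm⟩
  · obtain ⟨a, ha, haP, haZ⟩ := exists_avoids h₀ htN hP
    exact ⟨a, ha, haP, haZ Q h ⟨hQt, hQ⟩, haZ Z (hZ.trans h) hZt⟩

/-- The right-hand square of the last edge, with codomains identified with values of `X`, presents
the domain over `[t, n]` as a fibre product. Maps into that domain will be built from it. -/
lemma isPullback_toBase (h₀ : 0 < t)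
    (hc : IsIsoThenPullback (H.cell _ (misses_edge (inHorn_lastEdge htN h₀)))) :
    IsPullback (H.hom (pure_last_le_lastEdge htN) (inHorn_lastEdge_last htN h₀)).left
      (H.toBase hX (lastEdge htN) (inHorn_lastEdge htN h₀))
      (H.toBase hX (pure (Fin.last n)) (inHorn_lastEdge_last htN h₀).right)
      (X.map (IntervalCat.res (pure_last_le_lastEdge htN))) := by
  have e := H.cell_map (edge (lastEdge htN)) (misses_edge (inHorn_lastEdge htN h₀)) int1_le
  let α := eqToIso (H.cell_obj (edge (lastEdge htN)) (misses_edge (inHorn_lastEdge htN h₀)) int01)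
  let β := eqToIso (H.cell_obj (edge (lastEdge htN)) (misses_edge (inHorn_lastEdge htN h₀)) int1)
  rw [← Category.assoc] at e
  have e' := (Iso.eq_comp_inv β).1 e
  refine IsPullback.of_iso hc.isPullback (Arrow.leftFunc.mapIso α) (Arrow.leftFunc.mapIso β)
    (Arrow.rightFunc.mapIso α ≪≫ eqToIso (hX.obj_eq _ (inHorn_lastEdge htN h₀)).symm)
    (Arrow.rightFunc.mapIso β ≪≫ eqToIso (hX.obj_eq _ (inHorn_lastEdge_last htN h₀).right).symm)
    (congrArg (fun φ => φ.left) e') ?_ ?_ ?_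
  · exact (Arrow.w_assoc α.hom _).symm
  · exact (Arrow.w_assoc β.hom _).symm
  · rw [H.map_eq_right hX _ (inHorn_lastEdge_last htN h₀)]
    have e'' := congrArg (fun φ => φ.right) e'
    refine (Category.assoc _ _ _).symm.trans ((congrArg
      (· ≫ eqToHom (hX.obj_eq _ (inHorn_lastEdge_last htN h₀).right).symm) e'').trans ?_)
    refine (Category.assoc _ _ _).trans (Eq.trans ?_ (Category.assoc _ _ _).symm)
    exact congrArg (α.hom.right ≫ ·)
      ((eqToHom_trans_assoc (hX.obj_eq _ (inHorn_lastEdge htN h₀)).symm _ _).trans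
        (Category.id_comp _)).symm

/-- Either `Q` avoids `t`, and testing on `Z = Q` forces the map of the family, or `Q = [t, n]`, and
the map is determined by its composite to `{n}` and by the codomains. -/
lemma existsUnique_isStretchMap (h₀ : 0 < t) (ht : ∀ a, t < a → a = Fin.last n)
    (hc : IsIsoThenPullback (H.cell _ (misses_edge (inHorn_lastEdge htN h₀))))
    {P Q : NonemptyInterval (Fin (n + 1))} (hP : P.snd ≠ t) (hQ : Q.snd ≠ t) (h : Q ≤ P) :
    ∃! f, IsStretchMap t hX (inHorn_of_snd_ne h₀ htN hP) (inHorn_of_snd_ne h₀ htN hQ) h f := by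
  by_cases hQt : Q.fst = t
  · obtain rfl : Q = lastEdge htN := by
      ext1
      refine Prod.ext hQt (ht _ (lt_of_le_of_ne' (hQt.ge.trans Q.fst_le_snd) hQ))
    have hPB := isPullback_toBase (hX := hX) h₀ hc
    have w₂ : InHorn (Fin.last n) P (pure (Fin.last n)) :=
      inHorn_of_avoids h₀ htN hP ((pure_last_le_lastEdge htN).trans h) ⟨htN.ne', htN.ne'⟩
    have e := H.hom_left_toBase hX ((pure_last_le_lastEdge htN).trans h) w₂
    rw [← IntervalCat.map_res_comp X h (pure_last_le_lastEdge htN), ← Category.assoc] at e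
    refine ⟨hPB.lift _ _ e, ⟨hPB.lift_snd _ _ _, fun Z hZ w w' hZt => ?_⟩, fun f hf => ?_⟩
    · obtain rfl := eq_pure_last ht hZ.1 hZt
      exact hPB.lift_fst _ _ _
    · refine hPB.hom_ext ?_ ?_
      · rw [hPB.lift_fst]
        exact hf.2 _ _ _ _ ⟨htN.ne', htN.ne'⟩
      · rw [hPB.lift_snd]
        exact hf.1
  · refine ⟨_, isStretchMap_hom h₀ htN ht hP hQ h (inHorn_of_avoids h₀ htN hP h ⟨hQt, hQ⟩),
      fun f hf => ?_⟩
    have := hf.2 Q le_rfl (inHorn_of_snd_ne h₀ htN hQ) (inHorn_of_avoids h₀ htN hP h ⟨hQt, hQ⟩)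
      ⟨hQt, hQ⟩
    rw [hom_left_self, Category.comp_id] at this
    exact this

/-- Families on outer horns whose last edge is an isomorphism followed by a pullback extend over
a given extension of the codomains. -/
theorem exists_isFiller_outer_over
    [PreservesLimitsOfShape WalkingCospan (Arrow.leftFunc : Arrow C ⥤ C)]
    (hX : (H.postcomp Arrow.rightFunc).IsFiller X) (hPX : PullbackProperty X)
    (h₀ : 0 < t) (ht : ∀ a, t < a → a = Fin.last n)
    (hc : IsIsoThenPullback (H.cell _ (misses_edge (inHorn_lastEdge htN h₀)))) :
    ∃ G : IntervalCat (Fin (n + 1)) ⥤ Arrow C,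
      H.IsFiller G ∧ PullbackProperty G ∧ G ⋙ Arrow.rightFunc = X := by
  -- The domains form a functor on the intervals that do not end at `t`; precomposition with
  -- `stretch` extends it to all intervals.
  obtain ⟨m, hm, hid, hcomp⟩ := exists_functor_of_existsUnique
    (P := {P : IntervalCat (Fin (n + 1)) // (ofDual P).snd ≠ t})
    (fun P => (H.obj (ofDual P.1) (inHorn_of_snd_ne h₀ htN P.2)).left)
    (fun {P Q} h f => IsStretchMap t hX (inHorn_of_snd_ne h₀ htN P.2)
      (inHorn_of_snd_ne h₀ htN Q.2) h f)
    (fun P => isStretchMap_id _)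
    (fun {P Q R} h h' f g hf hg => hf.comp hg fun Z hZ => inHorn_of_avoids h₀ htN Q.2 hZ)
    (fun {P Q} h => (existsUnique_isStretchMap h₀ ht hc P.2 Q.2 h).exists)
    (fun {P Q} h _ _ hf hg => (existsUnique_isStretchMap h₀ ht hc P.2 Q.2 h).unique hf hg)
  let σ : IntervalCat (Fin (n + 1)) → {P : IntervalCat (Fin (n + 1)) // (ofDual P).snd ≠ t} :=
    fun I => ⟨toDual ((ofDual I).stretch t), stretch_snd_ne htN _⟩
  have hσ : ∀ {I J : IntervalCat (Fin (n + 1))}, I ≤ J → σ I ≤ σ J := fun h => stretch_mono ht h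
  have hw : ∀ I : NonemptyInterval (Fin (n + 1)), InHorn (Fin.last n) (I.stretch t)
    (I.stretch t) := fun I => inHorn_of_snd_ne h₀ htN (stretch_snd_ne htN _)
  -- The domain is read at the stretched interval and the codomain is exactly that of `X`, so the
  -- structure arrow restricts `X` from the stretched interval back to `I`.
  let G : IntervalCat (Fin (n + 1)) ⥤ Arrow C :=
    { obj I := Arrow.mk (H.toBase hX _ (hw (ofDual I)) ≫
        X.map (IntervalCat.res (le_stretch (t := t) (ofDual I))))
      map {I J} f := Arrow.homMk (m (hσ (leOfHom f))) (X.map f) (by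
        have h := (hm (hσ (leOfHom f))).1
        rw [IntervalCat.eq_res f]
        dsimp only [Arrow.mk_hom]
        rw [Category.assoc, IntervalCat.map_res_comp]
        refine ((reassoc_of% h) _).trans ?_
        exact congrArg (_ ≫ ·) (IntervalCat.map_res_comp X _ _))
      map_id I := Arrow.hom_ext _ _ (hid _) (X.map_id I)
      map_comp {I J K} f g := Arrow.hom_ext _ _ (hcomp _ _) (X.map_comp f g) }
  have hGm : ∀ {I J : NonemptyInterval (Fin (n + 1))} (h : J ≤ I) (w : InHorn (Fin.last n)
      (I.stretch t) (J.stretch t)), (G.map (IntervalCat.res h)).left =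
      (H.hom (stretch_mono ht h) w).left := fun {I J} h w =>
    (existsUnique_isStretchMap h₀ ht hc (stretch_snd_ne htN _) (stretch_snd_ne htN _)
      (stretch_mono ht h)).unique (hm _) (isStretchMap_hom h₀ htN ht (stretch_snd_ne htN _)
        (stretch_snd_ne htN _) _ w)
  have hs : ∀ I (_ : InHorn (Fin.last n) I I), InHorn (Fin.last n) (I.stretch t) I :=
    fun I ⟨a, ha, h, _⟩ => ⟨a, ha, h.stretch ha, h⟩
  -- For `I = [i, t]` the map from `[i, n]` is a pullback of the one from `[t, n]` to `{t}`, whose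
  -- domain part is invertible by hypothesis; other intervals are unchanged by stretching.
  have hiso : ∀ I (hI : InHorn (Fin.last n) I I),
      IsIso (H.hom (le_stretch (t := t) I) (hs I hI)).left := by
    intro I hI
    by_cases h : I.snd = t
    · by_cases h' : I = NonemptyInterval.pure t
      · subst h'
        have key : ∀ {P : NonemptyInterval (Fin (n + 1))} (e : P = lastEdge htN)
            (hP : NonemptyInterval.pure t ≤ P)
            (w : InHorn (Fin.last n) P (NonemptyInterval.pure t)), IsIso (H.hom hP w).left := by
          rintro _ rfl _ _
          exact isIso_hom_left h₀ hc
        exact key (by ext1; exact Prod.ext rfl (if_pos rfl)) _ _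
      · obtain ⟨a, ha, hI', -⟩ := id hI
        have hPB := (H.isPullback_hom (L := I.stretch t) (I := I) (J := lastEdge htN)
          (K := NonemptyInterval.pure t) (le_stretch I) ⟨I.fst_le_snd.trans h.le, (if_pos h).ge⟩
          ⟨I.fst_le_snd.trans h.le, h.ge⟩ (pure_le_lastEdge htN) rfl (if_pos h).symm rfl h.symm
          ⟨a, ha, hI', h.symm.trans_ne hI'.2, ha.symm⟩ (hs I hI)
          ⟨a, ha, hI'.stretch ha, h.symm.trans_ne hI'.2, ha.symm⟩
          ⟨a, ha, hI', h.symm.trans_ne hI'.2, h.symm.trans_ne hI'.2⟩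
          (inHorn_lastEdge_pure htN h₀)).map Arrow.leftFunc
        exact hPB.isIso_fst_of_isIso (isIso_hom_left h₀ hc)
    · have := H.isIso_hom (le_stretch I) (stretch_eq_self h).symm (hs I hI)
      exact inferInstanceAs (IsIso (Arrow.leftFunc.map (H.hom (le_stretch I) (hs I hI))))
  let ε : ∀ I (hI : InHorn (Fin.last n) I I), G.obj (toDual I) ≅ H.obj I hI := fun I hI =>
    Arrow.isoMk (@asIso _ _ _ _ _ (hiso I hI)) (eqToIso (hX.obj_eq I hI)) (by
      have h := H.hom_left_toBase hX (le_stretch (t := t) I) (hs I hI)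
      have e : H.toBase hX I hI ≫ eqToHom (hX.obj_eq I hI) = (H.obj I hI).hom :=
        (Category.assoc _ _ _).trans
          ((congrArg (_ ≫ ·) (eqToHom_trans _ _)).trans (Category.comp_id _))
      refine Eq.trans ?_ (congrArg (· ≫ eqToHom (hX.obj_eq I hI)) h)
      exact ((Category.assoc _ _ _).trans (congrArg (_ ≫ ·) e)).symm)
  have hε : ∀ {I J} (h : J ≤ I) (h' : InHorn (Fin.last n) I J),
      G.map (IntervalCat.res h) ≫ (ε J h'.right).hom = (ε I h'.left).hom ≫ H.hom h h' := by
    intro I J h h'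
    obtain ⟨a, ha, hI, hJ⟩ := id h'
    refine Arrow.hom_ext _ _ ?_ ?_
    · refine (congrArg (· ≫ _) (hGm h ⟨a, ha, hI.stretch ha, hJ.stretch ha⟩)).trans ?_
      exact (H.hom_left_comp _ _ ⟨a, ha, hI.stretch ha, hJ.stretch ha, hJ⟩ _
        (hs J h'.right) ⟨a, ha, hI.stretch ha, hJ⟩).trans
        (H.hom_left_comp _ _ ⟨a, ha, hI.stretch ha, hI, hJ⟩ (hs I h'.left) _ _).symm
    · have e := H.map_eq_right hX h h'
      exact (Iso.eq_comp_inv (eqToIso (hX.obj_eq J h'.right))).1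
        (e.trans (Category.assoc _ _ _).symm)
  have hPG : PullbackProperty G := by
    refine .of_isPullbackQuad fun i i' j' j w₁ w₂ w₃ => Arrow.isPullback ?_
      (hPX.isPullbackQuad w₁ w₂ w₃)
    -- If `i' < t`, the four stretched intervals avoid `t` and their square lies in the face
    -- opposite `t`. Otherwise the right endpoints all stretch to the last vertex, and the maps that
    -- shorten on the right are isomorphisms on domains.
    by_cases hi : i' < t
    · have hA : ∀ (I : NonemptyInterval (Fin (n + 1))), I.fst ≤ i' → Avoids t (I.stretch t) :=
        fun I hI => ⟨(hI.trans_lt hi).ne, stretch_snd_ne htN I⟩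
      have hA' : ∀ (I J : NonemptyInterval (Fin (n + 1))), I.fst ≤ i' → J.fst ≤ i' →
          InHorn (Fin.last n) (I.stretch t) (J.stretch t) :=
        fun I J hI hJ => ⟨t, htN.ne, hA I hI, hA J hJ⟩
      rw [hGm (I := IntervalCat.mk i j (w₁.trans (w₂.trans w₃)))
          (J := IntervalCat.mk i j' (w₁.trans w₂)) ⟨le_rfl, w₃⟩ (hA' _ _ w₁ w₁),
        hGm (I := IntervalCat.mk i j (w₁.trans (w₂.trans w₃)))
          (J := IntervalCat.mk i' j (w₂.trans w₃)) ⟨w₁, le_rfl⟩ (hA' _ _ w₁ le_rfl),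
        hGm (I := IntervalCat.mk i j' (w₁.trans w₂))
          (J := IntervalCat.mk i' j' w₂) ⟨w₁, le_rfl⟩ (hA' _ _ w₁ le_rfl),
        hGm (I := IntervalCat.mk i' j (w₂.trans w₃))
          (J := IntervalCat.mk i' j' w₂) ⟨le_rfl, w₃⟩ (hA' _ _ le_rfl le_rfl)]
      exact (H.isPullback_hom (L := (IntervalCat.mk i j (w₁.trans (w₂.trans w₃))).stretch t)
        (I := (IntervalCat.mk i j' (w₁.trans w₂)).stretch t)
        (J := (IntervalCat.mk i' j (w₂.trans w₃)).stretch t)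
        (K := (IntervalCat.mk i' j' w₂).stretch t) _ _ _ _ rfl rfl rfl rfl
        ⟨t, htN.ne, hA _ w₁, hA _ le_rfl⟩ (hA' _ _ w₁ w₁) (hA' _ _ w₁ le_rfl)
        (hA' _ _ w₁ le_rfl) (hA' _ _ le_rfl le_rfl)).map Arrow.leftFunc
    · have key : ∀ {I J : NonemptyInterval (Fin (n + 1))} (h : J ≤ I),
          I.fst = J.fst → t ≤ I.snd → t ≤ J.snd → IsIso (G.map (IntervalCat.res h)).left := by
        have key' : ∀ {P Q : {P : IntervalCat (Fin (n + 1)) // (ofDual P).snd ≠ t}} (h : P ≤ Q),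
            P = Q → IsIso (m h) := by
          rintro P _ h rfl
          rw [hid P]
          infer_instance
        intro I J h e hI hJ
        refine key' _ (Subtype.ext ?_)
        refine congrArg toDual ?_
        ext1
        exact Prod.ext e ((stretch_snd_eq_last ht hI).trans (stretch_snd_eq_last ht hJ).symm)
      have hi' := not_lt.1 hi
      have := key (I := IntervalCat.mk i j (w₁.trans (w₂.trans w₃)))
        (J := IntervalCat.mk i j' (w₁.trans w₂)) ⟨le_rfl, w₃⟩ rfl (hi'.trans (w₂.trans w₃))
        (hi'.trans w₂)
      have := key (I := IntervalCat.mk i' j (w₂.trans w₃))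
        (J := IntervalCat.mk i' j' w₂) ⟨le_rfl, w₃⟩ rfl (hi'.trans (w₂.trans w₃)) (hi'.trans w₂)
      refine IsPullback.of_horiz_isIso ⟨?_⟩
      exact congrArg Arrow.leftFunc.map ((IntervalCat.map_res_comp G _ _).trans
        (IntervalCat.map_res_comp G _ _).symm)
  -- The codomain part of `ε` consists of transports, so making the filler strict on the horn does
  -- not change the codomain functor.
  obtain ⟨G', hG', α, hPB', hα, hα'⟩ := exists_isFiller_of_iso hPG ε hε
  refine ⟨G', hG', hPB', (NatIso.functor_eq_of_app_eq_eqToHom (F := X)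
    (Functor.isoWhiskerRight α Arrow.rightFunc) fun I => ?_).symm⟩
  by_cases hI : InHorn (Fin.last n) (ofDual I) (ofDual I)
  · refine ⟨(hX.obj_eq _ hI).trans (congrArg Arrow.rightFunc.obj (hG'.obj_eq _ hI)).symm, ?_⟩
    refine (congrArg Arrow.rightFunc.map (hα _ hI)).trans ?_
    refine (congrArg (_ ≫ ·) (Arrow.eqToHom_right _)).trans (eqToHom_trans (hX.obj_eq _ hI) _)
  · obtain ⟨e, he⟩ := hα' _ hI
    exact ⟨congrArg Arrow.rightFunc.obj e,
      (congrArg Arrow.rightFunc.map he).trans (Arrow.eqToHom_right _)⟩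

end HornFamily

end OuterFiller

/-! ### Cartesian edges and outer horns -/

section JoinOperators

open AugmentedSimplexCategory

lemma tensorHomOf_apply_left {x₁ y₁ x₂ y₂ : SimplexCategory} (f₁ : x₁ ⟶ y₁) (f₂ : x₂ ⟶ y₂)
    (i : Fin (x₁.len + x₂.len + 1 + 1)) (hi : i.1 < x₁.len + 1) :
    ((tensorHomOf f₁ f₂).toOrderHom i).1 = (f₁.toOrderHom ⟨i.1, hi⟩).1 := by
  have h : inl' x₁ x₂ ≫ tensorHomOf f₁ f₂ = f₁ ≫ inl' y₁ y₂ :=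
    inl_comp_tensorHom (x₁ := .of x₁) (y₁ := .of y₁) (x₂ := .of x₂) (y₂ := .of y₂) f₁ f₂
  have h' := congrArg (fun g => (g.toOrderHom ⟨i.1, hi⟩).1) h
  have e₁ := inl'_eval x₁ x₂ ⟨i.1, hi⟩
  have e₂ := inl'_eval y₁ y₂ (f₁.toOrderHom ⟨i.1, hi⟩)
  have e₃ : (inl' x₁ x₂).toOrderHom ⟨i.1, hi⟩ = i := e₁.trans (Fin.ext rfl)
  have h'' : ((tensorHomOf f₁ f₂).toOrderHom ((inl' x₁ x₂).toOrderHom ⟨i.1, hi⟩)).1 =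
    ((inl' y₁ y₂).toOrderHom (f₁.toOrderHom ⟨i.1, hi⟩)).1 := h'
  rw [e₃, e₂] at h''
  exact h''

lemma tensorHomOf_apply_right {x₁ y₁ x₂ y₂ : SimplexCategory} (f₁ : x₁ ⟶ y₁) (f₂ : x₂ ⟶ y₂)
    (i : Fin (x₁.len + x₂.len + 1 + 1)) (j : Fin (x₂.len + 1)) (hi : i.1 = x₁.len + 1 + j.1) :
    ((tensorHomOf f₁ f₂).toOrderHom i).1 = y₁.len + 1 + (f₂.toOrderHom j).1 := by
  have h' := congrArg (fun g => (g.toOrderHom j).1) (inr'_comp_tensorHomOf f₁ f₂)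
  have e₂ := inr'_eval y₁ y₂ (f₂.toOrderHom j)
  have e₃ : (inr' x₁ x₂).toOrderHom j = i := (inr'_eval x₁ x₂ j).trans (Fin.ext hi.symm)
  have h'' : ((tensorHomOf f₁ f₂).toOrderHom ((inr' x₁ x₂).toOrderHom j)).1 =
    ((inr' y₁ y₂).toOrderHom (f₂.toOrderHom j)).1 := h'
  rw [e₃, e₂] at h''
  exact h''

lemma inr'_apply (x y : SimplexCategory) (i : Fin (y.len + 1)) :
    ((inr' x y).toOrderHom i).1 = x.len + 1 + i.1 := by
  rw [inr'_eval]
  rfl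

lemma δ_apply {n : ℕ} (j : Fin (n + 2)) (i : Fin (n + 1)) :
    ((SimplexCategory.δ j).toOrderHom i).1 = if i.1 < j.1 then i.1 else i.1 + 1 := by
  change (j.succAbove i).1 = _
  rw [Fin.succAbove]
  simp only [Fin.lt_def, Fin.val_castSucc]
  split_ifs <;> rfl

/-- The left factor of a join keeps its vertex numbers, so the omitted vertex has the same index in
the larger simplex. -/
lemma tensorHomOf_δ_id_one {m : ℕ} (i : Fin (m + 2)) :
    tensorHomOf (SimplexCategory.δ i) (𝟙 ⦋1⦌) =
      (SimplexCategory.δ i.castSucc.castSucc : ⦋m + 2⦌ ⟶ ⦋m + 3⦌) := by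
  ext l : 3
  have hl : l.1 < m + 3 := l.2
  refine Fin.ext (Eq.trans ?_ (δ_apply _ _).symm)
  by_cases h : l.1 < m + 1
  · exact (tensorHomOf_apply_left _ _ l h).trans (δ_apply _ _)
  · refine (tensorHomOf_apply_right _ _ l ⟨l.1 - (m + 1), show _ < 1 + 1 by omega⟩
      (show _ = m + 1 + (l.1 - (m + 1)) by omega)).trans ?_
    change m + 1 + 1 + (l.1 - (m + 1)) = if l.1 < i.1 then l.1 else l.1 + 1
    rw [if_neg (by omega)]
    omega

lemma tensorHomOf_δ_id_zero {m : ℕ} (i : Fin (m + 2)) :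
    tensorHomOf (SimplexCategory.δ i) (𝟙 ⦋0⦌) =
      (SimplexCategory.δ i.castSucc : ⦋m + 1⦌ ⟶ ⦋m + 2⦌) := by
  ext l : 3
  have hl : l.1 < m + 2 := l.2
  refine Fin.ext (Eq.trans ?_ (δ_apply _ _).symm)
  by_cases h : l.1 < m + 1
  · exact (tensorHomOf_apply_left _ _ l h).trans (δ_apply _ _)
  · refine (tensorHomOf_apply_right _ _ l ⟨l.1 - (m + 1), show _ < 0 + 1 by omega⟩
      (show _ = m + 1 + (l.1 - (m + 1)) by omega)).trans ?_
    change m + 1 + 1 + (l.1 - (m + 1)) = if l.1 < i.1 then l.1 else l.1 + 1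
    rw [if_neg (by omega)]
    omega

/-- Vertex `0` of the right factor is vertex `m + 1` of the join. -/
lemma tensorHomOf_id_δ_zero (m : ℕ) :
    tensorHomOf (𝟙 ⦋m⦌) (SimplexCategory.δ (0 : Fin 2)) =
      (SimplexCategory.δ (Fin.last (m + 1)).castSucc : ⦋m + 1⦌ ⟶ ⦋m + 2⦌) := by
  ext l : 3
  have hl : l.1 < m + 2 := l.2
  refine Fin.ext (Eq.trans ?_ (δ_apply _ _).symm)
  by_cases h : l.1 < m + 1
  · exact (tensorHomOf_apply_left _ _ l h).trans (if_pos h).symm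
  · refine (tensorHomOf_apply_right _ _ l ⟨l.1 - (m + 1), show _ < 0 + 1 by omega⟩
      (show _ = m + 1 + (l.1 - (m + 1)) by omega)).trans ?_
    rw [δ_apply]
    change m + 1 + (l.1 - (m + 1) + 1) = if l.1 < m + 1 then l.1 else l.1 + 1
    rw [if_neg h]
    omega

lemma inr'_comp_δ {m : ℕ} (i : Fin (m + 2)) :
    inr' ⦋m⦌ ⦋1⦌ ≫ (SimplexCategory.δ i.castSucc.castSucc : ⦋m + 2⦌ ⟶ ⦋m + 3⦌) =
      inr' ⦋m + 1⦌ ⦋1⦌ := by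
  rw [← tensorHomOf_δ_id_one, inr'_comp_tensorHomOf, Category.id_comp]

lemma inr'_zero_one : inr' ⦋0⦌ ⦋1⦌ = (SimplexCategory.δ 0 : ⦋1⦌ ⟶ ⦋2⦌) := by
  ext l : 3
  refine Fin.ext ((inr'_apply _ _ _).trans (Eq.trans ?_ (δ_apply _ _).symm))
  exact (Nat.add_comm _ _).trans (if_neg (Nat.not_lt_zero l.1)).symm

lemma inr'_zero_zero : inr' ⦋0⦌ ⦋0⦌ = (SimplexCategory.δ 0 : ⦋0⦌ ⟶ ⦋1⦌) := by
  ext l : 3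
  refine Fin.ext ((inr'_apply _ _ _).trans (Eq.trans ?_ (δ_apply _ _).symm))
  exact (Nat.add_comm _ _).trans (if_neg (Nat.not_lt_zero l.1)).symm

end JoinOperators

/-! ### Gluing faces into a last horn -/

namespace SSet

open AugmentedSimplexCategory

variable {X Y : SSet.{u}}

/-- Horns `Λ[m + 2, m + 2]` in `X` whose last edge is `f` have lifts over simplices of `Y`. -/
def LiftsLastHorns (p : X ⟶ Y) (f : X _⦋1⦌) : Prop :=
  ∀ (m : ℕ) (s : (horn.{u} (m + 2) (Fin.last (m + 2)) : SSet.{u}) ⟶ X) (B : Y _⦋m + 2⦌),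
    s ≫ p = (horn.{u} (m + 2) (Fin.last (m + 2))).ι ≫ yonedaEquiv.symm B →
    (∀ z : (horn.{u} (m + 2) (Fin.last (m + 2)) : SSet.{u}) _⦋1⦌,
      z.1 = stdSimplex.objEquiv.symm (inr' ⦋m⦌ ⦋1⦌) → s.app _ z = f) →
    ∃ w : X _⦋m + 2⦌, (horn.{u} (m + 2) (Fin.last (m + 2))).ι ≫ yonedaEquiv.symm w = s ∧
      p.app _ w = B

variable {p : X ⟶ Y} {f : X _⦋1⦌}

/-- Compatible faces glue to a horn. Its last edge lies in the face opposite `0`, so the condition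
on that edge is checked there, through `g`. -/
lemma LiftsLastHorns.exists_lift (h : LiftsLastHorns p f) {m : ℕ}
    (x : ∀ j : Fin (m + 3), j ≠ Fin.last (m + 2) → X _⦋m + 1⦌)
    (hx : ∀ (j k : Fin (m + 3)) (hj : j ≠ Fin.last (m + 2)) (hk : k ≠ Fin.last (m + 2))
      (hjk : j < k), X.δ (k.pred (Fin.ne_zero_of_lt hjk)) (x j hj) =
        X.δ (j.castPred (Fin.ne_last_of_lt hjk)) (x k hk))
    (B : Y _⦋m + 2⦌) (hB : ∀ j hj, p.app _ (x j hj) = Y.δ j B)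
    (g : ⦋1⦌ ⟶ ⦋m + 1⦌) (hg : g ≫ SimplexCategory.δ 0 = inr' ⦋m⦌ ⦋1⦌)
    (h₀ : (0 : Fin (m + 3)) ≠ Fin.last (m + 2))
    (hf : X.map g.op (x 0 h₀) = f) :
    ∃ w : X _⦋m + 2⦌, p.app _ w = B ∧ ∀ j hj, X.δ j w = x j hj := by
  have hc : horn.IsCompatible (n := m + 1) (i := Fin.last (m + 2))
      (fun j hj => yonedaEquiv.symm (x j hj)) := by
    intro j k hj hk hjk
    rw [stdSimplex.δ_comp_yonedaEquiv_symm, stdSimplex.δ_comp_yonedaEquiv_symm, hx j k hj hk hjk]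
  obtain ⟨s, hs⟩ := hc.exists_desc
  have hs' : s ≫ p = (horn.{u} (m + 2) (Fin.last (m + 2))).ι ≫ yonedaEquiv.symm B := by
    refine horn.hom_ext' fun j hj => ?_
    rw [reassoc_of% hs j hj, horn.ι_ι_assoc, stdSimplex.δ_comp_yonedaEquiv_symm, ← hB j hj]
    exact yonedaEquiv_symm_comp _ _
  have hsf : ∀ z : (horn.{u} (m + 2) (Fin.last (m + 2)) : SSet.{u}) _⦋1⦌,
      z.1 = stdSimplex.objEquiv.symm (inr' ⦋m⦌ ⦋1⦌) → s.app _ z = f := by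
    intro z hz
    have e : z = (horn.ι (Fin.last (m + 2)) 0 h₀).app _ (stdSimplex.objEquiv.symm g) := by
      refine Subtype.ext (hz.trans ?_)
      rw [← hg]
      rfl
    rw [e]
    have := congrArg (fun φ => φ.app (op ⦋1⦌) (stdSimplex.objEquiv.symm g)) (hs 0 h₀)
    exact Eq.trans this hf
  obtain ⟨w, hw, hwB⟩ := h m s B hs' hsf
  refine ⟨w, hwB, fun j hj => ?_⟩
  have := hs j hj
  rw [← hw, horn.ι_ι_assoc, stdSimplex.δ_comp_yonedaEquiv_symm] at this
  exact yonedaEquiv.symm.injective this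

/-- In `Δ[m] ⋆ Δ[1]`, the `U i` are the faces from `∂Δ[m] ⋆ Δ[1]` and `A` is `Δ[m] ⋆ {1}`, opposite
vertex `m + 1`. Only `Δ[m] ⋆ {0}`, opposite the last vertex, is missing. -/
lemma LiftsLastHorns.exists_lift_of_faces (h : LiftsLastHorns p f) {m : ℕ}
    (U : Fin (m + 1) → X _⦋m + 1⦌) (A : X _⦋m + 1⦌) (B : Y _⦋m + 2⦌)
    (hU : ∀ (i i' : Fin (m + 1)) (a b : Fin (m + 2)), i.1 < i'.1 → a.1 + 1 = i'.1 → b.1 = i.1 →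
      X.δ a (U i) = X.δ b (U i'))
    (hUA : ∀ i : Fin (m + 1), X.δ (Fin.last m).castSucc (U i) = X.δ i.castSucc A)
    (hUB : ∀ i, p.app _ (U i) = Y.δ i.castSucc.castSucc B)
    (hAB : p.app _ A = Y.δ (Fin.last (m + 1)).castSucc B)
    (g : ⦋1⦌ ⟶ ⦋m + 1⦌) (hg : g ≫ SimplexCategory.δ 0 = inr' ⦋m⦌ ⦋1⦌)
    (hf : X.map g.op (U 0) = f) :
    ∃ w : X _⦋m + 2⦌, p.app _ w = B ∧ X.map (inr' ⦋m⦌ ⦋1⦌).op w = f ∧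
      X.δ (Fin.last (m + 1)).castSucc w = A ∧
      ∀ i : Fin (m + 1), X.δ i.castSucc.castSucc w = U i := by
  let x : ∀ j : Fin (m + 3), j ≠ Fin.last (m + 2) → X _⦋m + 1⦌ :=
    fun j hj => Fin.lastCases (motive := fun _ => X _⦋m + 1⦌) A U (j.castPred hj)
  have hxA : ∀ h, x (Fin.last (m + 1)).castSucc h = A := fun h =>
    Fin.lastCases_last (motive := fun _ => X _⦋m + 1⦌) ..
  have hxU : ∀ i h, x (Fin.castSucc (Fin.castSucc i)) h = U i := fun i h =>
    Fin.lastCases_castSucc (motive := fun _ => X _⦋m + 1⦌) ..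
  have hx : ∀ (j k : Fin (m + 3)) (hj : j ≠ Fin.last (m + 2)) (hk : k ≠ Fin.last (m + 2))
      (hjk : j < k), X.δ (k.pred (Fin.ne_zero_of_lt hjk)) (x j hj) =
        X.δ (j.castPred (Fin.ne_last_of_lt hjk)) (x k hk) := by
    intro j k hj hk hjk
    obtain ⟨j, rfl⟩ := j.eq_castSucc_of_ne_last hj
    obtain ⟨k, rfl⟩ := k.eq_castSucc_of_ne_last hk
    induction j using Fin.lastCases with
    | last => exact absurd hjk (not_lt.2 (Fin.castSucc_le_castSucc_iff.2 (Fin.le_last k)))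
    | cast j =>
      rw [hxU]
      induction k using Fin.lastCases with
      | last =>
        rw [hxA]
        exact hUA j
      | cast k =>
        rw [hxU]
        have : j.1 < k.1 := hjk
        refine hU j k _ _ this ?_ rfl
        simp
        omega
  have hxB : ∀ j hj, p.app _ (x j hj) = Y.δ j B := by
    intro j hj
    obtain ⟨j, rfl⟩ := j.eq_castSucc_of_ne_last hj
    induction j using Fin.lastCases with
    | last => rw [hxA]; exact hAB
    | cast j => rw [hxU]; exact hUB j
  have h₀ : (0 : Fin (m + 3)) ≠ Fin.last (m + 2) := Fin.last_pos.ne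
  obtain ⟨w, hw, hw'⟩ := h.exists_lift x hx B hxB g hg h₀
    ((congrArg (X.map g.op) (hxU 0 h₀)).trans hf)
  have hw₀ : ∀ i : Fin (m + 1), X.δ i.castSucc.castSucc w = U i := fun i =>
    (hw' i.castSucc.castSucc (Fin.castSucc_lt_last _).ne).trans (hxU i _)
  refine ⟨w, hw, ?_, (hw' (Fin.last (m + 1)).castSucc (Fin.castSucc_lt_last _).ne).trans
    (hxA _), hw₀⟩
  rw [← hg, op_comp, Functor.map_comp_apply]
  exact (congrArg (X.map g.op) (hw₀ 0)).trans hf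

end SSet

/-! ### Lifting problems between slices -/

namespace SSet

open AugmentedSimplexCategory

variable {X Y : SSet.{u}} {p : X ⟶ Y} {f : X _⦋1⦌}

lemma sliceComparison_fst (p : X ⟶ Y) (f : X _⦋1⦌) :
    sliceComparison p f ≫ pullback.fst _ _ =
      sliceMap (𝟙 X) (SimplexCategory.δ 0) f (X.target f) rfl :=
  pullback.lift_fst _ _ _

lemma sliceComparison_snd (p : X ⟶ Y) (f : X _⦋1⦌) :
    sliceComparison p f ≫ pullback.snd _ _ =
      sliceMap p (𝟙 ⦋1⦌) f (p.app _ f) (by simp) :=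
  pullback.lift_snd _ _ _

lemma map_tensorHomOf_id (X : SSet.{u}) {m k : SimplexCategory}
    (x : X.obj (op (tensorObjOf m k))) : X.map (tensorHomOf (𝟙 m) (𝟙 k)).op x = x := by
  rw [tensorHomOf_id, op_id, Functor.map_id_apply]

lemma yonedaEquiv_symm_comp_apply {n : SimplexCategory} (x : X.obj (op n)) (q : X ⟶ Y) :
    yonedaEquiv (yonedaEquiv.symm x ≫ q) = q.app _ x := by
  rw [yonedaEquiv_comp, Equiv.apply_symm_apply]

lemma slice_δ_val_one {f : X _⦋1⦌} {m : ℕ} (i : Fin (m + 2)) (x : (X.slice f) _⦋m + 1⦌) :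
    ((X.slice f).δ i x).1 = X.δ (n := m + 2) i.castSucc.castSucc x.1 := by
  change X.map (tensorHomOf (SimplexCategory.δ i) (𝟙 ⦋1⦌)).op x.1 = _
  rw [tensorHomOf_δ_id_one]
  rfl

lemma slice_δ_val_zero {y : X _⦋0⦌} {m : ℕ} (i : Fin (m + 2)) (x : (X.slice y) _⦋m + 1⦌) :
    ((X.slice y).δ i x).1 = X.δ (n := m + 1) i.castSucc x.1 := by
  change X.map (tensorHomOf (SimplexCategory.δ i) (𝟙 ⦋0⦌)).op x.1 = _
  rw [tensorHomOf_δ_id_zero]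
  rfl

lemma δ_slice_val_one {f : X _⦋1⦌} (x : (X.slice f) _⦋0⦌) : X.δ (n := 1) 0 x.1 = f := by
  obtain ⟨x, hx⟩ := x
  change X.map (inr' ⦋0⦌ ⦋1⦌).op x = f at hx
  rw [inr'_zero_one] at hx
  exact hx

lemma δ_slice_val_zero {y : X _⦋0⦌} (x : (X.slice y) _⦋0⦌) : X.δ (n := 0) 0 x.1 = y := by
  obtain ⟨x, hx⟩ := x
  change X.map (inr' ⦋0⦌ ⦋0⦌).op x = y at hx
  rw [inr'_zero_zero] at hx
  exact hx

lemma sliceMap_δ_val {m : ℕ} (q : X ⟶ Y) (f : X _⦋1⦌) (y : Y _⦋0⦌) (h)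
    (x : (X.slice f) _⦋m⦌) :
    ((sliceMap q (SimplexCategory.δ (0 : Fin 2)) f y h).app (op ⦋m⦌) x).1 =
      Y.δ (n := m + 1) (Fin.last (m + 1)).castSucc (q.app _ x.1) := by
  change Y.map (tensorHomOf (𝟙 ⦋m⦌) (SimplexCategory.δ (0 : Fin 2))).op _ = _
  rw [tensorHomOf_id_δ_zero]
  rfl

lemma sliceMap_id_val {k m : SimplexCategory} (q : X ⟶ Y) (f : X.obj (op k)) (y : Y.obj (op k)) (h)
    (x : (X.slice f).obj (op m)) :
    ((sliceMap q (𝟙 k) f y h).app (op m) x).1 = q.app _ x.1 :=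
  map_tensorHomOf_id Y _

variable {m : ℕ}

/-- Lifting problems against the comparison map of slices, in terms of simplices. -/
lemma hasLift_sliceComparison {u : (boundary.{u} m : SSet.{u}) ⟶ X.slice f}
    {v : (Δ[m] : SSet.{u}) ⟶ _} (sq : CommSq u (boundary.{u} m).ι (sliceComparison p f) v)
    (w : X _⦋m + 2⦌) (hwB : p.app _ w = (yonedaEquiv (v ≫ pullback.snd _ _)).1)
    (hwf : X.map (inr' ⦋m⦌ ⦋1⦌).op w = f)
    (hwA : X.δ (Fin.last (m + 1)).castSucc w = (yonedaEquiv (v ≫ pullback.fst _ _)).1)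
    (hwu : (boundary.{u} m).ι ≫ yonedaEquiv.symm (⟨w, hwf⟩ : (X.slice f) _⦋m⦌) = u) :
    sq.HasLift := by
  refine ⟨⟨_, hwu, pullback.hom_ext ?_ ?_⟩⟩
  · rw [Category.assoc, sliceComparison_fst]
    exact yonedaEquiv.injective ((yonedaEquiv_symm_comp_apply _ _).trans
      (Subtype.ext ((sliceMap_δ_val _ _ _ _ _).trans hwA)))
  · rw [Category.assoc, sliceComparison_snd]
    exact yonedaEquiv.injective ((yonedaEquiv_symm_comp_apply _ _).trans
      (Subtype.ext ((sliceMap_id_val _ _ _ _ _).trans hwB)))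

/-- This unwinds a simplex of the fibre product of slices: its component in `X` lies over the face
of its component in `Y` opposite the source of `g`. -/
lemma app_eq_δ_of_comp_eq {y : X _⦋0⦌} {g : Y _⦋1⦌} {z : Y _⦋0⦌} (q₁ : Δ[m] ⟶ X.slice y)
    (q₂ : Δ[m] ⟶ Y.slice g) (h₁ : Y.map (𝟙 ⦋0⦌).op (p.app _ y) = z)
    (h₂ : Y.map (SimplexCategory.δ 0).op ((𝟙 Y : Y ⟶ Y).app (op ⦋1⦌) g) = z)
    (e : q₁ ≫ sliceMap p (𝟙 ⦋0⦌) y z h₁ = q₂ ≫ sliceMap (𝟙 Y) (SimplexCategory.δ 0) g z h₂) :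
    p.app _ (yonedaEquiv q₁).1 =
      Y.δ (n := m + 1) (Fin.last (m + 1)).castSucc (yonedaEquiv q₂).1 := by
  have h := congrArg (fun z : (Y.slice z) _⦋m⦌ => z.1) (congrArg yonedaEquiv e)
  exact (sliceMap_id_val p y z h₁ (yonedaEquiv q₁)).symm.trans
    (h.trans (sliceMap_δ_val (𝟙 Y) g z h₂ (yonedaEquiv q₂)))

/-- Lifts of horns whose last edge is `f` show that `f` is cartesian. -/
theorem LiftsLastHorns.isCartesianEdge (h : LiftsLastHorns p f) : IsCartesianEdge p f := by
  intro m
  refine ⟨fun {u v} sq => ?_⟩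
  have hAB := app_eq_δ_of_comp_eq (v ≫ pullback.fst _ _) (v ≫ pullback.snd _ _) _ _
    ((Category.assoc _ _ _).trans ((congrArg (v ≫ ·) pullback.condition).trans
      (Category.assoc _ _ _).symm))
  obtain _ | m := m
  -- The boundary of `Δ[0]` is empty, but its join with `Δ[1]` is `Δ[1]`; the single face `U 0` is
  -- therefore `f`.
  · have hA := δ_slice_val_zero (yonedaEquiv (v ≫ pullback.fst _ _))
    have hB := δ_slice_val_one (yonedaEquiv (v ≫ pullback.snd _ _))
    obtain ⟨w, hw, hwf, hwA, -⟩ := h.exists_lift_of_faces (m := 0) (fun _ => f)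
      (yonedaEquiv (v ≫ pullback.fst _ _)).1 (yonedaEquiv (v ≫ pullback.snd _ _)).1
      (fun i i' _ _ hi => absurd hi (by omega)) (fun i => by
        obtain rfl := Fin.fin_one_eq_zero i
        exact hA.symm) (fun i => by
        obtain rfl := Fin.fin_one_eq_zero i
        exact hB.symm) hAB (𝟙 _) (by rw [Category.id_comp, inr'_zero_one])
        (by rw [op_id, Functor.map_id_apply])
    exact hasLift_sliceComparison sq w hw hwf hwA boundary.hom_ext₀
  · let U : Fin (m + 2) → (X.slice f) _⦋m⦌ := fun i => yonedaEquiv (boundary.ι i ≫ u)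
    have hUA : ∀ i, X.δ (Fin.last (m + 1)).castSucc (U i).1 =
        X.δ (n := m + 1) i.castSucc (yonedaEquiv (v ≫ pullback.fst _ _)).1 := by
      intro i
      have e : boundary.ι i ≫ u ≫ sliceMap (𝟙 X) (SimplexCategory.δ 0) f (X.target f) rfl =
          stdSimplex.δ i ≫ v ≫ pullback.fst _ _ := by
        rw [← sliceComparison_fst p f, ← boundary.ι_ι_assoc, sq.w_assoc]
      have e' := (congrArg yonedaEquiv e).trans (stdSimplex.yonedaEquiv_δ_comp _ _)
      replace e' := congrArg (fun z : (X.slice (X.target f)) _⦋m⦌ => z.1) e'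
      exact (sliceMap_δ_val (𝟙 X) f (X.target f) rfl (U i)).symm.trans
        (e'.trans (slice_δ_val_zero _ _))
    have hUB : ∀ i, p.app _ (U i).1 =
        Y.δ (n := m + 2) i.castSucc.castSucc (yonedaEquiv (v ≫ pullback.snd _ _)).1 := by
      intro i
      have e : boundary.ι i ≫ u ≫ sliceMap p (𝟙 ⦋1⦌) f (p.app _ f) (by simp) =
          stdSimplex.δ i ≫ v ≫ pullback.snd _ _ := by
        rw [← sliceComparison_snd p f, ← boundary.ι_ι_assoc, sq.w_assoc]
      have e' := (congrArg yonedaEquiv e).trans (stdSimplex.yonedaEquiv_δ_comp _ _)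
      replace e' := congrArg (fun z : (Y.slice (p.app _ f)) _⦋m⦌ => z.1) e'
      exact (sliceMap_id_val p f (p.app _ f) (by simp) (U i)).symm.trans
        (e'.trans (slice_δ_val_one _ _))
    have hU : ∀ (i i' : Fin (m + 2)) (a b : Fin (m + 3)), i.1 < i'.1 → a.1 + 1 = i'.1 →
        b.1 = i.1 → X.δ (n := m + 1) a (U i).1 = X.δ (n := m + 1) b (U i').1 := by
      intro i i' a b hi ha hb
      -- The two vertices of `∂Δ[1]` have no common face in the slice, yet the corresponding
      -- 2-simplices share the edge `f`. In higher dimensions the simplicial identities suffice.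
      obtain _ | k := m
      · have ha' : a = 0 := Fin.ext (by simp; omega)
        have hb' : b = 0 := Fin.ext (by simp; omega)
        rw [ha', hb']
        exact (δ_slice_val_one _).trans (δ_slice_val_one _).symm
      · have hi0 : i' ≠ 0 := Fin.ne_of_gt (lt_of_le_of_lt (Fin.zero_le _) (Fin.lt_def.2 hi))
        have hil : i ≠ Fin.last _ := Fin.ne_of_lt (lt_of_lt_of_le (Fin.lt_def.2 hi) (Fin.le_last _))
        have e : stdSimplex.δ (i'.pred hi0) ≫ boundary.ι i ≫ u =
            stdSimplex.δ (i.castPred hil) ≫ boundary.ι i' ≫ u := by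
          rw [← Category.assoc, ← Category.assoc]
          congr 1
          rw [← cancel_mono (boundary _).ι, Category.assoc, Category.assoc, boundary.ι_ι,
            boundary.ι_ι]
          have := stdSimplex.δ_comp_δ (i := i.castPred hil) (j := i'.pred hi0)
            (by rw [Fin.le_def]; simp; omega)
          simpa using this.symm
        have e' := congrArg yonedaEquiv e
        rw [stdSimplex.yonedaEquiv_δ_comp, stdSimplex.yonedaEquiv_δ_comp] at e'
        replace e' := congrArg (fun z : (X.slice f) _⦋k⦌ => z.1) e'
        have ha' : a = (i'.pred hi0).castSucc.castSucc := Fin.ext (by simp; omega)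
        have hb' : b = (i.castPred hil).castSucc.castSucc := Fin.ext (by simp; omega)
        rw [ha', hb']
        exact (slice_δ_val_one _ _).symm.trans (e'.trans (slice_δ_val_one _ _))
    obtain ⟨w, hw, hwf, hwA, hwU⟩ := h.exists_lift_of_faces (m := m + 1) (fun i => (U i).1)
      (yonedaEquiv (v ≫ pullback.fst _ _)).1 (yonedaEquiv (v ≫ pullback.snd _ _)).1
      hU hUA hUB hAB (inr' ⦋m⦌ ⦋1⦌) (inr'_comp_δ 0) (U 0).2
    refine hasLift_sliceComparison sq w hw hwf hwA (boundary.hom_ext fun i => ?_)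
    apply yonedaEquiv.injective
    rw [boundary.ι_ι_assoc, stdSimplex.yonedaEquiv_δ_comp]
    refine (congrArg ((X.slice f).δ i) (yonedaEquiv.apply_symm_apply _)).trans ?_
    exact Subtype.ext ((slice_δ_val_one _ _).trans (hwU i))

end SSet

/-! ### Construction of the identity-then-pullback lift -/

section ExplicitLift

variable {C : Type u₁} [Category.{v₁} C] {n : ℕ}

/-- The functor that sends an arrow of a functor category to a functor to the arrow category. -/
def arrowFunctorOf {J : Type*} [Category J] {F G : J ⥤ C} (τ : F ⟶ G) : J ⥤ Arrow C where
  obj j := Arrow.mk (τ.app j)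
  map f := Arrow.homMk (F.map f) (G.map f) (τ.naturality f)

/-- The left endpoint of an interval. -/
def IntervalCat.fstFunctor (n : ℕ) : IntervalCat (Fin (n + 1)) ⥤ Fin (n + 1) :=
  Monotone.functor (f := fun I => (ofDual I).fst) fun _ _ h => h.1

/-- The interval between a vertex and the last vertex. -/
def IntervalCat.upTo (n : ℕ) : Fin (n + 1) ⥤ IntervalCat (Fin (n + 1)) :=
  Monotone.functor (f := fun i => toDual ⟨(i, Fin.last n), Fin.le_last i⟩)
    fun _ _ h => ⟨h, le_rfl⟩

/-- An interval is contained in the interval between its left endpoint and the last vertex. -/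
def IntervalCat.fstUpTo (n : ℕ) : IntervalCat.fstFunctor n ⋙ IntervalCat.upTo n ⟶ 𝟭 _ where
  app I := homOfLE (show ofDual I ≤ _ from ⟨le_rfl, Fin.le_last _⟩)

lemma isIso_map_of_eq {J : Type*} [Preorder J] (M : J ⥤ C) {a b : J} (f : a ⟶ b) (h : a = b) :
    IsIso (M.map f) := by
  subst h
  rw [Subsingleton.elim f (𝟙 a), M.map_id]
  infer_instance

/-- Shortening an interval on the right keeps its left endpoint, so two opposite sides of every
square are isomorphisms. -/
lemma pullbackProperty_fstFunctor_comp (M : Fin (n + 1) ⥤ C) :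
    PullbackProperty (IntervalCat.fstFunctor n ⋙ M) := by
  refine .of_isPullbackQuad fun i i' j' j h₁ h₂ h₃ => ?_
  have : IsIso ((IntervalCat.fstFunctor n ⋙ M).map (IntervalCat.res
      (L := IntervalCat.mk i j (h₁.trans (h₂.trans h₃)))
      (I := IntervalCat.mk i j' (h₁.trans h₂)) ⟨le_rfl, h₃⟩)) := isIso_map_of_eq M _ rfl
  have : IsIso ((IntervalCat.fstFunctor n ⋙ M).map (IntervalCat.res
      (L := IntervalCat.mk i' j (h₂.trans h₃)) (I := IntervalCat.mk i' j' h₂) ⟨le_rfl, h₃⟩)) :=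
    isIso_map_of_eq M _ rfl
  exact IsPullback.of_horiz_isIso ⟨by simp only [IntervalCat.map_res_comp]⟩

/-- The identity-then-pullback lift of a span `G` along `q : T ⟶ G₁`, given `P ⟶ T` and
`P ⟶ G₀₁`. -/
def spanLift (G : IntervalCat (Fin 2) ⥤ C) {P T : C} (r : P ⟶ T)
    (s : P ⟶ G.obj (toDual int01)) (q : T ⟶ G.obj (toDual int1))
    (w : r ≫ q = s ≫ G.map (IntervalCat.res int1_le)) : IntervalCat (Fin 2) ⥤ Arrow C :=
  -- Domains depend only on the left endpoint, so `{0}` and `{0, 1}` share `P` and the left leg is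
  -- an identity. The arrow at `I` passes through the value of `G` at the interval from `I.fst` to
  -- `1`.
  arrowFunctorOf (F := IntervalCat.fstFunctor 1 ⋙ ComposableArrows.mk₁ r) (G := G)
    (Functor.whiskerLeft (IntervalCat.fstFunctor 1)
        (ComposableArrows.homMk₁ (F := ComposableArrows.mk₁ r) (G := IntervalCat.upTo 1 ⋙ G)
          s q w) ≫
      Functor.whiskerRight (IntervalCat.fstUpTo 1) G)

section SpanLift

variable {G : IntervalCat (Fin 2) ⥤ C} {P T : C} {r : P ⟶ T}
    {s : P ⟶ G.obj (toDual int01)} {q : T ⟶ G.obj (toDual int1)}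

lemma pullbackProperty_spanLift (w : r ≫ q = s ≫ G.map (IntervalCat.res int1_le))
    (hG : PullbackProperty G) : PullbackProperty (spanLift G r s q w) := fun I J K L hK hL =>
  Arrow.isPullback (pullbackProperty_fstFunctor_comp (ComposableArrows.mk₁ r) I J K L hK hL)
    (hG I J K L hK hL)

lemma spanLift_obj_int1 (w : r ≫ q = s ≫ G.map (IntervalCat.res int1_le)) :
    (spanLift G r s q w).obj (toDual int1) = Arrow.mk q := by
  refine congrArg Arrow.mk ((congrArg (q ≫ ·) ?_).trans (Category.comp_id q))
  exact IntervalCat.map_res_self G le_rfl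

lemma spanLift_map_int0 (w : r ≫ q = s ≫ G.map (IntervalCat.res int1_le)) :
    ((spanLift G r s q w).map (IntervalCat.res int0_le)).left = 𝟙 P :=
  (ComposableArrows.mk₁ r).map_id 0

lemma isPullback_spanLift (w : IsPullback r s q (G.map (IntervalCat.res int1_le))) :
    IsPullback ((spanLift G r s q w.w).map (IntervalCat.res int1_le)).left
      ((spanLift G r s q w.w).obj (toDual int01)).hom
      ((spanLift G r s q w.w).obj (toDual int1)).hom
      ((spanLift G r s q w.w).map (IntervalCat.res int1_le)).right := by
  have e₁ : ((spanLift G r s q w.w).obj (toDual int1)).hom = q :=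
    (congrArg (q ≫ ·) (IntervalCat.map_res_self G le_rfl)).trans (Category.comp_id q)
  have e₂ : ((spanLift G r s q w.w).obj (toDual int01)).hom = s :=
    (congrArg (s ≫ ·) (IntervalCat.map_res_self G le_rfl)).trans (Category.comp_id s)
  rw [e₁, e₂]
  exact w

end SpanLift

/-- The functor `X ↦ 𝟙 X`. -/
def arrowOfId (C : Type u₁) [Category.{v₁} C] : C ⥤ Arrow C where
  obj X := Arrow.mk (𝟙 X)
  map f := Arrow.homMk f f

/-- The domain functor `(X ⟶ Y) ↦ X` is right adjoint to `X ↦ 𝟙 X`. -/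
def arrowOfIdAdj (C : Type u₁) [Category.{v₁} C] :
    arrowOfId C ⊣ (Arrow.leftFunc : Arrow C ⥤ C) :=
  Adjunction.mkOfHomEquiv
    { homEquiv _ A :=
        { toFun φ := φ.left
          invFun f := Arrow.homMk f (f ≫ A.hom) (Category.id_comp _).symm
          left_inv φ := Arrow.hom_ext _ _ rfl ((Arrow.w φ).trans (Category.id_comp _))
          right_inv _ := rfl }
      homEquiv_naturality_left_symm _ _ :=
        Arrow.hom_ext _ _ rfl (Category.assoc _ _ _)
      homEquiv_naturality_right _ _ := rfl }

instance preservesLimitsOfShape_leftFunc (C : Type u₁) [Category.{v₁} C] :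
    PreservesLimitsOfShape WalkingCospan (Arrow.leftFunc : Arrow C ⥤ C) :=
  (arrowOfIdAdj C).rightAdjoint_preservesLimits.preservesLimitsOfShape

lemma IntervalCat.functor_ext_zero {F G : IntervalCat (Fin 1) ⥤ C}
    (h : F.obj (toDual (NonemptyInterval.pure 0)) = G.obj (toDual (NonemptyInterval.pure 0))) :
    F = G := by
  have : Subsingleton (IntervalCat (Fin 1)) :=
    ⟨fun I J => congrArg toDual (NonemptyInterval.ext (Subsingleton.elim I.toProd J.toProd))⟩
  refine CategoryTheory.Functor.ext (fun I => ?_) fun I J f => ?_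
  · rw [Subsingleton.elim I (toDual (NonemptyInterval.pure 0))]
    exact h
  · obtain rfl := Subsingleton.elim I J
    rw [Subsingleton.elim f (𝟙 _)]
    simp

lemma Arrow.mk_hom_comp_eqToHom (a : Arrow C) {Z : C} (e : a.right = Z) :
    Arrow.mk (a.hom ≫ eqToHom e) = a := by
  subst e
  exact congrArg Arrow.mk (Category.comp_id _)

/-- Edges of `Span(C)` lift to edges of `Span(Arr(C))` of identity-then-pullback form. -/
lemma exists_isIdentityThenPullback (g : FinSpan.{u} _⦋1⦌) (y : FinSpanTimes.{u} _⦋0⦌)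
    (h : codSpan.app _ y = FinSpan.target g) :
    ∃ f : FinSpanTimes.{u} _⦋1⦌,
      codSpan.app _ f = g ∧ FinSpanTimes.target f = y ∧ IsIdentityThenPullback f := by
  let a := (Span.diagram y).obj (toDual (NonemptyInterval.pure (0 : Fin 1)))
  have e : a.right = (Span.diagram g).obj (toDual int1) :=
    congrArg (fun z : FinSpan.{u} _⦋0⦌ =>
      (Span.diagram z).obj (toDual (NonemptyInterval.pure (0 : Fin 1)))) h
  have w := IsPullback.of_hasPullback (a.hom ≫ eqToHom e)
    ((Span.diagram g).map (IntervalCat.res int1_le))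
  refine ⟨⟨spanLift (Span.diagram g) _ _ _ w.w, pullbackProperty_spanLift w.w g.2⟩, rfl, ?_,
    ⟨⟨rfl, spanLift_map_int0 w.w⟩, isPullback_spanLift w⟩⟩
  refine Subtype.ext (IntervalCat.functor_ext_zero ?_)
  exact (spanLift_obj_int1 w.w).trans (Arrow.mk_hom_comp_eqToHom a e)

lemma IsIdentityThenPullback.isIsoThenPullback {f : FinSpanTimes.{u} _⦋1⦌}
    (h : IsIdentityThenPullback f) : IsIsoThenPullback (Span.diagram f) where
  isIso := by
    obtain ⟨e, he⟩ := h.exists_eq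
    exact (congrArg (fun φ => IsIso φ) he).mpr inferInstance
  isPullback := h.isPullback

open HornFamily AugmentedSimplexCategory

lemma IsIsoThenPullback.liftsLastHorns {f : FinSpanTimes.{u} _⦋1⦌}
    (hf : IsIsoThenPullback (Span.diagram f)) : SSet.LiftsLastHorns codSpan.{u} f := by
  intro m s B hs hsf
  have hX : ((ofHorn s).postcomp Arrow.rightFunc).IsFiller (Span.diagram B) := by
    intro l x hx
    have := isFiller_of_ι_comp _ (SSet.yonedaEquiv.symm B) hs.symm x hx
    rw [Equiv.apply_symm_apply] at this
    exact this
  -- The vertex `t = m + 1` is the penultimate one, and `inr' ⦋m⦌ ⦋1⦌` is the edge from it to the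
  -- last vertex.
  have htN : (⟨m + 1, by omega⟩ : Fin (m + 3)) < Fin.last (m + 2) := Nat.lt_succ_self _
  have h₀ : (0 : Fin (m + 3)) < ⟨m + 1, by omega⟩ := Nat.succ_pos _
  have hc : IsIsoThenPullback ((ofHorn s).cell _ (misses_edge (inHorn_lastEdge htN h₀))) := by
    have e : SimplexCategory.Hom.mk (NonemptyInterval.edge (lastEdge htN)) = inr' ⦋m⦌ ⦋1⦌ := by
      refine SimplexCategory.Hom.ext _ _ (OrderHom.ext _ _ (funext fun i => ?_))
      refine Fin.ext (Eq.trans ?_ (inr'_apply _ _ _).symm)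
      fin_cases i <;> rfl
    have e' := hsf (hornSimplex.{u, u + 1} _ (misses_edge (inHorn_lastEdge htN h₀)))
      (congrArg SSet.stdSimplex.objEquiv.symm e)
    exact (congrArg (fun z : FinSpanTimes.{u} _⦋1⦌ => IsIsoThenPullback (Span.diagram z))
      e').mpr hf
  obtain ⟨G, hG, hPG, e⟩ := exists_isFiller_outer_over hX B.2 h₀
    (fun a ha => Fin.ext (by
      have h₁ : m + 1 < a.1 := ha
      have h₂ := a.2
      change a.1 = m + 2
      omega)) hc
  exact ⟨⟨G, hPG⟩, ι_comp_of_isFiller s hG hPG, Subtype.ext e⟩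

end ExplicitLift

theorem mainTheorem8 :
    SSet.IsCartesianFibration codSpan.{u} ∧
    ∀ (g : FinSpan.{u} _⦋1⦌) (y : FinSpanTimes.{u} _⦋0⦌),
      codSpan.app _ y = FinSpan.target g →
      ∃ f : FinSpanTimes.{u} _⦋1⦌,
        codSpan.app _ f = g ∧ FinSpanTimes.target f = y ∧
        IsIdentityThenPullback f ∧ SSet.IsCartesianEdge codSpan f := by
  have key (g : FinSpan.{u} _⦋1⦌) (y : FinSpanTimes.{u} _⦋0⦌)
      (h : codSpan.app _ y = FinSpan.target g) :
      ∃ f : FinSpanTimes.{u} _⦋1⦌,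
        codSpan.app _ f = g ∧ FinSpanTimes.target f = y ∧
        IsIdentityThenPullback f ∧ SSet.IsCartesianEdge codSpan f := by
    obtain ⟨f, hfg, hfy, hf⟩ := exists_isIdentityThenPullback g y h
    exact ⟨f, hfg, hfy, hf, hf.isIsoThenPullback.liftsLastHorns.isCartesianEdge⟩
  exact ⟨⟨inferInstance, inferInstance, innerFibration_codSpan, fun g y h =>
    let ⟨f, hfg, hfy, _, hf⟩ := key g y h
    ⟨f, hfg, hfy, hf⟩⟩, key⟩
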